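/- **Setting.** Consider a rooted tree with root (feeder) $0$ and finitely many further nodes $i=1,\dots,I$; the edge entering $k\neq 0$ from its parent $\pi(k)$ has resistance $R_k>0$ and reactance $X_k\in\mathbb R$. $\mathcal N(k)$ denotes the set of nodes of the subtree rooted at $k$. There are finitely many types $j=1,\dots,J$ of electric vehicles (EVs). Let $M_i>0$ (node capacities), $c_j^{\max}>0$ (maximal charging rates), $\lambda_{ij}>0$ (arrival rates), $K_i\in\{1,2,\dots\}\cup\{\infty\}$ (parking spaces), and let $W_{00}$ (squared feeder voltage) and the voltage limits satisfy $0<\underline\upsilon_k<W_{00}\le\overline\upsilon_k$ for all $k\ne 0$. The charging requirement and parking time $(B_j,D_j)$ of a type-$j$ EV have an arbitrary joint law with $B_j>0$, $D_j>0$ a.s. and $\mathbb E[D_j]<\infty$. The utilities $u_{ij}$ are strictly increasing and concave on $[0,\infty)$ (the value $u_{ij}(0)=-\infty$ is allowed), real valued and twice differentiable on $(0,\infty)$, with $u_{ij}'(x)\to\infty$ as $x\downarrow 0$. For $z\ge 0$, rates $p$ are *feasible* if $\sum_j z_{ij}p_{ij}\le M_i$, $0\le p_{ij}\le c_j^{\max}$,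 and the loads $\Lambda_{ij}=z_{ij}p_{ij}$ satisfy the voltage constraints of one of the following models (the same model throughout). * *AC model*: there are reals $W_{kk}$ ($k\ne0$) and $W_{\pi(k)k}$ such that for all $k\neq0$: $\underline\upsilon_k\le W_{kk}\le\overline\upsilon_k$, the matrix $\begin{pmatrix}W_{\pi(k)\pi(k)}&W_{\pi(k)k}\\W_{\pi(k)k}&W_{kk}\end{pmatrix}$ is positive semidefinite of rank one, and $W_{\pi(k)k}-W_{kk}-P_kR_k-Q_kX_k=0$, where $P_k=\sum_{l\in\mathcal N(k)}\sum_j\Lambda_{lj}+\sum_{s\in\mathcal N(k)\setminus\{k\}}\ell_sR_s$, $Q_k=\sum_{s\in\mathcal N(k)\setminus\{k\}}\ell_sX_s$ and $\ell_s=(W_{\pi(s)\pi(s)}-2W_{\pi(s)s}+W_{ss})/(R_s^2+X_s^2)$. * *Linearized Distflow model*: $\underline\upsilon_k\le W_{00}-2\sum_{s:\,k\in\mathcal N(s)}R_s\sum_{l\in\mathcal N(s)}\sum_j\Lambda_{lj}\le\overline\upsilon_k$ for all $k\ne0$. An *allocation mechanism* is a function $z\mapsto p(z)$ on $\{z\ge0\}$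 such that $p(z)$ maximizes $\sum_{i,j}z_{ij}u_{ij}(p_{ij})$ (with $0\cdot(-\infty)=0$) over the feasible $p$, and $p_{ij}(z)=0$ whenever $z_{ij}=0$. It is *monotone* if $0<y\le z$ (coordinatewise, all $y_{ij}>0$) implies $p_{ij}(y)\ge p_{ij}(z)$ for all $i,j$. A nonnegative continuous function $z(\cdot)$ on $[0,\infty)$ is a *fluid-model solution* for nonnegative initial charging requirements and parking times $(B^0_{ij},D^0_{ij})$ if, for some initial total populations $q_{ij}(0)\ge z_{ij}(0)$ and all $t\ge0$, $$z_{ij}(t)=z_{ij}(0)\,\mathbb P\Big(B^0_{ij}>\int_0^tp_{ij}(z(v))dv,\;D^0_{ij}\ge t\Big)+\int_0^t\gamma_{ij}(s)\,\mathbb P\Big(B_j>\int_s^tp_{ij}(z(v))dv,\;D_j\ge t-s\Big)ds,$$ $$q_{ij}(t)=q_{ij}(0)\,\mathbb P(D^0_{ij}\ge t)+\int_0^t\gamma_{ij}(s)\,\mathbb P(D_j\ge t-s)\,ds,\qquad \gamma_{ij}(t)=\lambda_{ij}\mathbf 1\Big\{\sum_{j'}q_{ij'}(t)<K_i\Big\}.$$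 An *invariant point* is a vector $z^*$ such that $z(t)\equiv z^*$ is a fluid-model solution for some initial laws. **Proposition 2.** Suppose that the allocation mechanism is monotone, that $K_i=\infty$ for all $i$, and that, for every $j$, the leftmost point of the support of $D_j/B_j$ is at most $1/c_j^{\max}$. Then the fluid model has a unique invariant point $z^*$, this $z^*$ is also the unique nonnegative solution of $$z^*_{ij}=\lambda_{ij}\,\mathbb E\Big[\min\Big\{D_j,\frac{B_j}{p_{ij}(z^*)}\Big\}\Big]\qquad(B_j/0:=\infty),$$ and every fluid-model solution, for any initial data, satisfies $z_{ij}(t)\to z^*_{ij}$ as $t\to\infty$ for all $i,j$. -/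

import Mathlib

open MeasureTheory Filter Topology Set
open scoped ENNReal

noncomputable section

namespace EVCharging

/-- A utility function on `[0, ∞)`. It is real valued on `(0, ∞)`; the value at `0` may be `-∞`
(as for `log`), hence the codomain `EReal`. Concavity up to `0` follows from monotonicity and
concavity on `(0, ∞)`. -/
structure IsUtility (u : ℝ → EReal) : Prop where
  finite : ∀ x, 0 < x → u x ≠ ⊥ ∧ u x ≠ ⊤
  strictMono : StrictMonoOn u (Ici 0)
  concave : ConcaveOn ℝ (Ioi 0) (fun x => (u x).toReal)
  differentiable : DifferentiableOn ℝ (fun x => (u x).toReal) (Ioi 0)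
  differentiable_deriv : DifferentiableOn ℝ (deriv (fun x => (u x).toReal)) (Ioi 0)
  deriv_zero : Tendsto (deriv (fun x => (u x).toReal)) (𝓝[>] 0) atTop

/-- The data of the charging network. `ι` is the set of nodes other than the feeder and `J` the set
of vehicle types. In `Option ι`, `none` is the feeder and `some i` the node `i`. The edge that
enters node `k` (from `parent k`) is indexed by `k`. -/
structure Network (ι J : Type*) [Fintype ι] [Fintype J] where
  /-- the parent in the rooted tree -/
  parent : ι → Option ι
  /-- there are no cycles: every node is below the feeder -/
  acyclic : WellFounded (fun a b : ι => parent b = some a)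
  /-- resistance of the edge entering `k` -/
  R : ι → ℝ
  R_pos : ∀ k, 0 < R k
  /-- reactance of the edge entering `k` -/
  X : ι → ℝ
  /-- squared voltage magnitude at the feeder -/
  W₀ : ℝ
  /-- lower and upper limits for the squared voltage magnitudes -/
  vLow : ι → ℝ
  vHigh : ι → ℝ
  vLow_pos : ∀ k, 0 < vLow k
  vLow_lt : ∀ k, vLow k < W₀
  le_vHigh : ∀ k, W₀ ≤ vHigh k
  /-- power capacity of node `i` -/
  M : ι → ℝ
  M_pos : ∀ i, 0 < M i
  /-- maximal charging rate of type `j` -/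
  cmax : J → ℝ
  cmax_pos : ∀ j, 0 < cmax j
  /-- number of parking spaces, possibly infinite -/
  K : ι → ℕ∞
  K_pos : ∀ i, 0 < K i
  /-- arrival rates -/
  lam : ι → J → ℝ
  lam_pos : ∀ i j, 0 < lam i j
  /-- joint law of (charging requirement, parking time) = `(B j, D j)` for type `j` -/
  F : J → Measure (ℝ × ℝ)
  F_prob : ∀ j, IsProbabilityMeasure (F j)
  F_pos : ∀ j, ∀ᵐ x ∂(F j), 0 < x.1 ∧ 0 < x.2
  /-- parking times have finite mean -/
  F_mean : ∀ j, Integrable (fun x : ℝ × ℝ => x.2) (F j)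
  /-- utility functions -/
  u : ι → J → ℝ → EReal
  u_utility : ∀ i j, IsUtility (u i j)

/-- The two load flow models. -/
inductive FlowModel
  | ac
  | linDistflow

namespace Network

variable {ι J : Type*} [Fintype ι] [Fintype J] (N : Network ι J)

/-- `N.Below k l`: node `l` belongs to the subtree rooted at `k` (including `k` itself). -/
def Below (k l : ι) : Prop := Relation.ReflTransGen (fun a b : ι => N.parent b = some a) k l

open Classical in
/-- Nodes of the subtree rooted at `k`. -/
def subtree (k : ι) : Finset ι := Finset.univ.filter (fun l => N.Below k l)

open Classical in
/-- Edges of the subtree rooted at `k`, each indexed by its lower endpoint. -/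
def subtreeEdges (k : ι) : Finset ι := (N.subtree k).erase k

open Classical in
/-- Edges of the path from the feeder to `k`, each indexed by its lower endpoint. -/
def path (k : ι) : Finset ι := Finset.univ.filter (fun s => N.Below s k)

/-- The matrix `W(ε)` of the edge entering `k`, from the diagonal entries `w` (indexed by nodes)
and the off-diagonal entries `o` (indexed by edges). -/
def edgeMatrix (w : Option ι → ℝ) (o : ι → ℝ) (k : ι) : Matrix (Fin 2) (Fin 2) ℝ :=
  !![w (N.parent k), o k; o k, w (some k)]

/-- Active power loss along the edge entering `s`. -/
def lossP (w : Option ι → ℝ) (o : ι → ℝ) (s : ι) : ℝ :=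
  (w (N.parent s) - 2 * o s + w (some s)) * N.R s / (N.R s ^ 2 + N.X s ^ 2)

/-- Reactive power loss along the edge entering `s`. -/
def lossQ (w : Option ι → ℝ) (o : ι → ℝ) (s : ι) : ℝ :=
  (w (N.parent s) - 2 * o s + w (some s)) * N.X s / (N.R s ^ 2 + N.X s ^ 2)

/-- Active power consumed by the subtree rooted at `k`, when type-`j` vehicles at node `l` consume
`L l j` in total. -/
def powerP (L : ι → J → ℝ) (w : Option ι → ℝ) (o : ι → ℝ) (k : ι) : ℝ :=
  ∑ l ∈ N.subtree k, ∑ j, L l j + ∑ s ∈ N.subtreeEdges k, N.lossP w o s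

/-- Reactive power consumed by the subtree rooted at `k`. -/
def powerQ (w : Option ι → ℝ) (o : ι → ℝ) (k : ι) : ℝ :=
  ∑ s ∈ N.subtreeEdges k, N.lossQ w o s

/-- The loads `L` satisfy the voltage constraints of the AC model: there are voltages `W` solving
the power flow equations, within the limits, with positive semidefinite rank-one edge matrices. -/
def ACFeasible (L : ι → J → ℝ) : Prop :=
  ∃ (w : Option ι → ℝ) (o : ι → ℝ), w none = N.W₀ ∧
    (∀ k, N.vLow k ≤ w (some k) ∧ w (some k) ≤ N.vHigh k) ∧
    (∀ k, o k - w (some k) - N.powerP L w o k * N.R k - N.powerQ w o k * N.X k = 0) ∧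
    (∀ k, (N.edgeMatrix w o k).PosSemidef ∧ (N.edgeMatrix w o k).rank = 1)

/-- Squared voltage magnitude at node `k` in the linearized Distflow model. -/
def Wlin (L : ι → J → ℝ) (k : ι) : ℝ :=
  N.W₀ - 2 * ∑ s ∈ N.path k, N.R s * ∑ m ∈ N.subtree s, ∑ j, L m j

/-- The loads `L` satisfy the voltage constraints of the given load flow model. -/
def VoltageFeasible (m : FlowModel) (L : ι → J → ℝ) : Prop :=
  match m with
  | .ac => N.ACFeasible L
  | .linDistflow => ∀ k, N.vLow k ≤ N.Wlin L k ∧ N.Wlin L k ≤ N.vHigh k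

/-- `p` is a feasible vector of charging rates in state `z`: load and voltage constraints. -/
def Feasible (m : FlowModel) (z p : ι → J → ℝ) : Prop :=
  (∀ i, ∑ j, z i j * p i j ≤ N.M i) ∧ (∀ i j, 0 ≤ p i j ∧ p i j ≤ N.cmax j) ∧
    N.VoltageFeasible m (fun i j => z i j * p i j)

/-- The total utility of the rates `p` in state `z` (in `EReal`, `0 * (-∞) = 0`). -/
def objective (z p : ι → J → ℝ) : EReal :=
  ∑ i, ∑ j, ((z i j : ℝ) : EReal) * N.u i j (p i j)

/-- `p` is an allocation mechanism: `p z` maximizes the total utility under the constraints, with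
the convention that `p z i j = 0` when `z i j = 0`. -/
def IsAllocation (m : FlowModel) (p : (ι → J → ℝ) → ι → J → ℝ) : Prop :=
  ∀ z : ι → J → ℝ, (∀ i j, 0 ≤ z i j) →
    N.Feasible m z (p z) ∧ (∀ q, N.Feasible m z q → N.objective z q ≤ N.objective z (p z)) ∧
    ∀ i j, z i j = 0 → p z i j = 0

/-- Modified arrival rate in the fluid model, given the total fluid `q` at the nodes. -/
def gammaT (q : ℝ → ι → J → ℝ) (i : ι) (j : J) (t : ℝ) : ℝ :=
  open Classical in
  if ENNReal.ofReal (∑ j', q t i j') < (N.K i : ℝ≥0∞) then N.lam i j else 0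

/-- `z` is a fluid-model solution, where `F₀ i j` is the joint law of the charging requirement and
the parking time of the type-`j` vehicles that are initially at node `i`. -/
def IsFluidSolution (p : (ι → J → ℝ) → ι → J → ℝ) (F₀ : ι → J → Measure (ℝ × ℝ))
    (z : ℝ → ι → J → ℝ) : Prop :=
  (∀ i j, IsProbabilityMeasure (F₀ i j) ∧ ∀ᵐ x ∂(F₀ i j), 0 ≤ x.1 ∧ 0 ≤ x.2) ∧
  (∀ t, 0 ≤ t → ∀ i j, 0 ≤ z t i j) ∧
  ContinuousOn z (Ici 0) ∧
  (∀ t, 0 ≤ t → ∀ i j, IntervalIntegrable (fun v => p (z v) i j) volume 0 t) ∧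
  ∃ q : ℝ → ι → J → ℝ,
    (∀ i j, z 0 i j ≤ q 0 i j) ∧
    (∀ t, 0 ≤ t → ∀ i j, IntervalIntegrable (N.gammaT q i j) volume 0 t) ∧
    (∀ t, 0 ≤ t → ∀ i j, q t i j =
      q 0 i j * (F₀ i j).real {x | t ≤ x.2} +
        ∫ s in (0 : ℝ)..t, N.gammaT q i j s * (N.F j).real {x | t - s ≤ x.2}) ∧
    (∀ t, 0 ≤ t → ∀ i j, z t i j =
      z 0 i j * (F₀ i j).real {x | (∫ v in (0 : ℝ)..t, p (z v) i j) < x.1 ∧ t ≤ x.2} +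
        ∫ s in (0 : ℝ)..t, N.gammaT q i j s *
          (N.F j).real {x | (∫ v in s..t, p (z v) i j) < x.1 ∧ t - s ≤ x.2})

/-- `y` is an invariant point of the fluid model: for a suitable initial population the constant
function `y` is a fluid-model solution. -/
def IsInvariantPoint (p : (ι → J → ℝ) → ι → J → ℝ) (y : ι → J → ℝ) : Prop :=
  ∃ F₀ : ι → J → Measure (ℝ × ℝ), N.IsFluidSolution p F₀ (fun _ => y)

/-- The equilibrium arrival rate `γ i j`. -/
def gammaInf (i : ι) (j : J) : ℝ≥0∞ :=
  ENNReal.ofReal (N.lam i j) / ENNReal.ofReal (∑ j', N.lam i j') *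
    min (ENNReal.ofReal (∑ j', N.lam i j'))
      ((N.K i : ℝ≥0∞) * (∑ j', ENNReal.ofReal (N.lam i j') / ENNReal.ofReal (∑ k, N.lam i k) *
        ∫⁻ x, ENNReal.ofReal x.2 ∂(N.F j'))⁻¹)

/-- The fixed-point equation `y = γ E[min(D, B / p(y))]`, where `B / 0 = ∞`. -/
def IsFixedPoint (p : (ι → J → ℝ) → ι → J → ℝ) (y : ι → J → ℝ) : Prop :=
  ∀ i j, 0 ≤ y i j ∧ ENNReal.ofReal (y i j) = N.gammaInf i j *
    ∫⁻ x, min (ENNReal.ofReal x.2) (ENNReal.ofReal x.1 / ENNReal.ofReal (p y i j)) ∂(N.F j)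

/-- The leftmost point of the support of the law of `D j / B j`. -/
def infRatio (j : J) : ℝ := sInf ((N.F j).map (fun x : ℝ × ℝ => x.2 / x.1)).support

end Network

/-- Monotone allocation mechanism. -/
def IsMonotone {ι J : Type*} (p : (ι → J → ℝ) → ι → J → ℝ) : Prop :=
  ∀ y z : ι → J → ℝ, (∀ i j, 0 < y i j) → (∀ i j, y i j ≤ z i j) → ∀ i j, p z i j ≤ p y i j

end EVCharging

end

/-!
By Little's law, the type-`j` vehicles charged at the constant rate `r` form a stationary population
of mean size `λ E[min(D, B / r)]`, so the invariant points are the fixed points of the map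
`Φ z = λ E[min(D, B / p z)]`. Monotonicity of `p` makes `Φ` monotone, and Knaster–Tarski gives a
fixed point.

The key is a comparison principle: if `0 < y ≤ w`, `Φ y ≤ y` and `w ≤ Φ w`, then `y = w`. The mean
charge `r E[min(D, B / r)] = E[min(r D, B)]` received by a vehicle is strictly increasing in
`r ≤ cmax`, thanks to the assumption on the support of `D / B`. As `p w ≤ p y`, the loads satisfy
`w p(w) ≤ λ E[min(p(w) D, B)] ≤ λ E[min(p(y) D, B)] ≤ y p(y)`. But the loads of `y` remain feasible
in state `w`, so optimality of `p w` and strict monotonicity of the utilities force equality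
throughout. Applied to the infimum and the supremum of two fixed points, this gives uniqueness.

For convergence, let `ℓ` and `u` be the lower and upper limits of a fluid-model solution `z`. For
`θ < 1`, eventually `θ ℓ ≤ z t`, so the charging rates are at most `p (θ ℓ)`, and hence
`Φ (θ ℓ) ≤ ℓ`; letting `θ → 1` gives `Φ ℓ ≤ ℓ`, and likewise `u ≤ Φ u`. By comparison `ℓ = u`. The
continuity of `p` at positive states used here again follows from optimality, applied to the
one-sided limits of `p (θ y)`.

Optimal utilities are finite because small positive loads are feasible. In the AC model these come
from the voltages `√W₀ - ε h`, where `h` increases along each edge by its resistance times a flow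
that decays fast enough with the depth for every node to consume power; the losses are of second
order in `ε`.
-/

noncomputable section

namespace EVCharging

section Sojourn

variable {r s : ℝ} {x : ℝ × ℝ}

/-- The time `min d (b / r)` spent in the system by a vehicle with charging requirement
`b = x.1 > 0` and parking time `d = x.2 > 0` that is charged at the constant rate `r ≥ 0`. Written
as a single quotient so that `r = 0` correctly yields `d`, in spite of `b / 0 = 0`. -/
def sojourn (r : ℝ) (x : ℝ × ℝ) : ℝ := x.2 * x.1 / max x.1 (r * x.2)

lemma sojourn_pos (hx : 0 < x.1 ∧ 0 < x.2) : 0 < sojourn r x :=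
  div_pos (mul_pos hx.2 hx.1) (lt_max_of_lt_left hx.1)

lemma sojourn_le_snd (hx : 0 < x.1 ∧ 0 < x.2) : sojourn r x ≤ x.2 := by
  rw [sojourn, div_le_iff₀ (lt_max_of_lt_left hx.1)]
  exact mul_le_mul_of_nonneg_left (le_max_left _ _) hx.2.le

lemma norm_sojourn_le_snd (hx : 0 < x.1 ∧ 0 < x.2) : ‖sojourn r x‖ ≤ x.2 :=
  (Real.norm_of_nonneg (sojourn_pos hx).le).trans_le (sojourn_le_snd hx)

lemma sojourn_anti (hx : 0 < x.1 ∧ 0 < x.2) (hrs : r ≤ s) : sojourn s x ≤ sojourn r x := by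
  have hb := hx.1
  have hd := hx.2
  unfold sojourn
  gcongr

lemma mul_sojourn (hx : 0 < x.1 ∧ 0 < x.2) : r * sojourn r x = min (r * x.2) x.1 := by
  have hmax : 0 < max x.1 (r * x.2) := lt_max_of_lt_left hx.1
  rw [sojourn, ← mul_div_assoc, div_eq_iff hmax.ne', max_comm, min_mul_max]
  ring

lemma sojourn_zero (hx : 0 < x.1 ∧ 0 < x.2) : sojourn 0 x = x.2 := by
  simp [sojourn, max_eq_left hx.1.le, hx.1.ne']

lemma sojourn_of_pos (hr : 0 < r) (hx : 0 < x.1 ∧ 0 < x.2) : sojourn r x = min x.2 (x.1 / r) := by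
  refine mul_left_cancel₀ hr.ne' ?_
  rw [mul_sojourn hx, mul_min_of_nonneg _ _ hr.le, mul_div_cancel₀ _ hr.ne']

lemma ofReal_sojourn (hr : 0 ≤ r) (hx : 0 < x.1 ∧ 0 < x.2) :
    ENNReal.ofReal (sojourn r x) =
      min (ENNReal.ofReal x.2) (ENNReal.ofReal x.1 / ENNReal.ofReal r) := by
  rcases hr.eq_or_lt with rfl | hr
  · rw [sojourn_zero hx, ENNReal.ofReal_zero, ENNReal.div_zero (by simpa using hx.1), min_top_right]
  · rw [sojourn_of_pos hr hx, ENNReal.ofReal_min, ENNReal.ofReal_div_of_pos hr]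

@[fun_prop]
lemma measurable_sojourn : Measurable (sojourn r) := by
  unfold sojourn
  fun_prop

lemma continuous_sojourn (hx : 0 < x.1 ∧ 0 < x.2) : Continuous (fun r => sojourn r x) :=
  Continuous.div (by fun_prop) (by fun_prop) fun _ => (lt_max_of_lt_left hx.1).ne'

lemma measurableSet_uncharged : MeasurableSet {y : ℝ × (ℝ × ℝ) | r * y.1 < y.2.1 ∧ y.1 ≤ y.2.2} :=
  (measurableSet_lt (measurable_const.mul measurable_fst) measurable_snd.fst).inter
    (measurableSet_le measurable_fst measurable_snd.snd)

lemma volume_setOf_uncharged (hr : 0 ≤ r) (hx : 0 < x.1 ∧ 0 < x.2) :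
    volume.restrict (Ioi 0) {v | r * v < x.1 ∧ v ≤ x.2} = ENNReal.ofReal (sojourn r x) := by
  have hmeas : MeasurableSet {v | r * v < x.1 ∧ v ≤ x.2} :=
    measurable_prodMk_right measurableSet_uncharged
  rw [Measure.restrict_apply hmeas]
  refine le_antisymm ?_ ?_
  · have hsub : {v : ℝ | r * v < x.1 ∧ v ≤ x.2} ∩ Ioi 0 ⊆ Ioc 0 (sojourn r x) := by
      rintro v ⟨⟨hrv, hvd⟩, hv : 0 < v⟩
      refine ⟨hv, ?_⟩
      rw [sojourn, le_div_iff₀ (lt_max_of_lt_left hx.1), mul_max_of_nonneg _ _ hv.le]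
      refine max_le (mul_le_mul_of_nonneg_right hvd hx.1.le) ?_
      nlinarith [hx.2]
    simpa using measure_mono (μ := volume) hsub
  · have hsub : Ioo 0 (sojourn r x) ⊆ {v : ℝ | r * v < x.1 ∧ v ≤ x.2} ∩ Ioi 0 := by
      rintro v ⟨hv, hvs⟩
      refine ⟨⟨?_, (hvs.trans_le (sojourn_le_snd hx)).le⟩, hv⟩
      rcases hr.eq_or_lt with rfl | hr
      · simpa using hx.1
      · calc r * v < r * sojourn r x := mul_lt_mul_of_pos_left hvs hr
          _ ≤ x.1 := (mul_sojourn hx).trans_le (min_le_right _ _)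
    simpa using measure_mono (μ := volume) hsub

end Sojourn

section MeanSojourn

variable {μ : Measure (ℝ × ℝ)} {r c : ℝ}

/-- The mean time `E[min(D, B / r)]` spent in the system by a vehicle charged at the constant rate
`r`, when `μ` is the joint law of the charging requirement `B` and the parking time `D`. -/
def meanSojourn (μ : Measure (ℝ × ℝ)) (r : ℝ) : ℝ := ∫ x, sojourn r x ∂μ

lemma integrable_sojourn (hpos : ∀ᵐ x ∂μ, 0 < x.1 ∧ 0 < x.2) (hint : Integrable (fun x => x.2) μ) :
    Integrable (sojourn r) μ :=
  hint.mono' measurable_sojourn.aestronglyMeasurable (hpos.mono fun _ => norm_sojourn_le_snd)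

lemma antitone_meanSojourn (hpos : ∀ᵐ x ∂μ, 0 < x.1 ∧ 0 < x.2)
    (hint : Integrable (fun x => x.2) μ) : Antitone (meanSojourn μ) := fun _ _ hrs =>
  integral_mono_ae (integrable_sojourn hpos hint) (integrable_sojourn hpos hint)
    (hpos.mono fun _ hx => sojourn_anti hx hrs)

lemma meanSojourn_pos [NeZero μ] (hpos : ∀ᵐ x ∂μ, 0 < x.1 ∧ 0 < x.2)
    (hint : Integrable (fun x => x.2) μ) : 0 < meanSojourn μ r := by
  have hnonneg : 0 ≤ᵐ[μ] sojourn r := hpos.mono fun _ hx => (sojourn_pos hx).le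
  rw [meanSojourn, integral_pos_iff_support_of_nonneg_ae hnonneg (integrable_sojourn hpos hint),
    pos_iff_ne_zero]
  exact frequently_ae_mem_iff.1 (hpos.mono fun _ hx => (sojourn_pos hx).ne').frequently

lemma continuous_meanSojourn (hpos : ∀ᵐ x ∂μ, 0 < x.1 ∧ 0 < x.2)
    (hint : Integrable (fun x => x.2) μ) : Continuous (meanSojourn μ) :=
  continuous_of_dominated (fun _ => measurable_sojourn.aestronglyMeasurable)
    (fun _ => hpos.mono fun _ => norm_sojourn_le_snd) hint
    (hpos.mono fun _ => continuous_sojourn)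

lemma frequently_mul_snd_lt_fst [NeZero μ] (hpos : ∀ᵐ x ∂μ, 0 < x.1 ∧ 0 < x.2)
    (hinf : sInf (μ.map fun x => x.2 / x.1).support ≤ 1 / c) (hr : 0 ≤ r) (hrc : r < c) :
    ∃ᵐ x ∂μ, r * x.2 < x.1 := by
  rcases hr.eq_or_lt with rfl | hr
  · exact (hpos.mono fun x hx => by simpa using hx.1).frequently
  have hmeas : Measurable fun x : ℝ × ℝ => x.2 / x.1 := by fun_prop
  have : NeZero (μ.map fun x => x.2 / x.1) :=
    ⟨(Measure.map_ne_zero_iff hmeas.aemeasurable).2 (NeZero.ne μ)⟩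
  obtain ⟨a, ha, har⟩ := exists_lt_of_csInf_lt (Measure.nonempty_support (NeZero.ne _))
    (hinf.trans_lt (one_div_lt_one_div_of_lt hr hrc))
  have hratio : ∃ᵐ x ∂μ, x.2 / x.1 < 1 / r := by
    have hIio := (Measure.mem_support_iff_forall a).1 ha _ (Iio_mem_nhds har)
    rw [Measure.map_apply hmeas measurableSet_Iio] at hIio
    exact frequently_ae_iff.2 hIio.ne'
  refine (hratio.and_eventually hpos).mono ?_
  rintro x ⟨hx, hb, hd⟩
  rw [div_lt_div_iff₀ hb hr] at hx
  linarith

lemma strictMonoOn_mul_meanSojourn [NeZero μ] (hpos : ∀ᵐ x ∂μ, 0 < x.1 ∧ 0 < x.2)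
    (hint : Integrable (fun x => x.2) μ)
    (hinf : sInf (μ.map fun x => x.2 / x.1).support ≤ 1 / c) :
    StrictMonoOn (fun r => r * meanSojourn μ r) (Icc 0 c) := by
  intro r hr s hs hrs
  have hint' (r : ℝ) : Integrable (fun x => r * sojourn r x) μ :=
    (integrable_sojourn hpos hint).const_mul r
  have hle : (fun x => r * sojourn r x) ≤ᵐ[μ] fun x => s * sojourn s x := by
    filter_upwards [hpos] with x hx
    rw [mul_sojourn hx, mul_sojourn hx]
    exact min_le_min_right _ (mul_le_mul_of_nonneg_right hrs.le hx.2.le)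
  simp only [meanSojourn, ← integral_const_mul]
  refine (integral_mono_ae (hint' r) (hint' s) hle).lt_of_ne fun heq => ?_
  rw [integral_eq_iff_of_ae_le (hint' r) (hint' s) hle] at heq
  refine frequently_mul_snd_lt_fst hpos hinf hr.1 (hrs.trans_le hs.2) ?_
  filter_upwards [heq, hpos] with x hx hxpos hrx
  rw [mul_sojourn hxpos, mul_sojourn hxpos, min_eq_left hrx.le] at hx
  exact (lt_min (mul_lt_mul_of_pos_right hrs hxpos.2) hrx).ne hx

end MeanSojourn

section Presence

variable {μ : Measure (ℝ × ℝ)} {P Q : ℝ → ℝ} {r s t T : ℝ}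

/-- The probability that a vehicle that arrived at time `s` is at time `t` neither fully charged nor
gone, when it is charged at rate `P v` at time `v`. -/
def presence (μ : Measure (ℝ × ℝ)) (P : ℝ → ℝ) (t s : ℝ) : ℝ :=
  μ.real {x | (∫ v in s..t, P v) < x.1 ∧ t - s ≤ x.2}

/-- The probability that a vehicle charged at the constant rate `r` is at age `v` neither fully
charged nor gone. -/
def survival (μ : Measure (ℝ × ℝ)) (r v : ℝ) : ℝ := μ.real {x | r * v < x.1 ∧ v ≤ x.2}

lemma presence_nonneg : 0 ≤ presence μ P t s := measureReal_nonneg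

lemma survival_nonneg : 0 ≤ survival μ r t := measureReal_nonneg

lemma presence_const : presence μ (fun _ => r) t s = survival μ r (t - s) := by
  simp only [presence, survival, intervalIntegral.integral_const, smul_eq_mul, mul_comm]

lemma integral_presence_const :
    ∫ v in s..t, presence μ (fun _ => r) t v = ∫ v in 0..t - s, survival μ r v := by
  simp only [presence_const]
  rw [intervalIntegral.integral_comp_sub_left (survival μ r), sub_self]

lemma presence_anti [IsFiniteMeasure μ] (hst : s ≤ t) (hP : IntervalIntegrable P volume s t)
    (hQ : IntervalIntegrable Q volume s t) (hPQ : ∀ v ∈ Icc s t, P v ≤ Q v) :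
    presence μ Q t s ≤ presence μ P t s :=
  measureReal_mono fun _ hx =>
    ⟨(intervalIntegral.integral_mono_on hst hP hQ hPQ).trans_lt hx.1, hx.2⟩

lemma monotoneOn_presence [IsFiniteMeasure μ] (hP : IntervalIntegrable P volume s t)
    (hP0 : ∀ v ∈ Icc s t, 0 ≤ P v) : MonotoneOn (presence μ P t) (Icc s t) := by
  intro a ha b hb hab
  have hmem {v : ℝ} (hv : v ∈ Icc s t) : v ∈ uIcc s t := Icc_subset_uIcc hv
  refine measureReal_mono fun x hx => ⟨lt_of_le_of_lt ?_ hx.1, (sub_le_sub_left hab t).trans hx.2⟩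
  rw [← intervalIntegral.integral_add_adjacent_intervals
    (hP.mono_set (uIcc_subset_uIcc (hmem ha) (hmem hb)))
    (hP.mono_set (uIcc_subset_uIcc (hmem hb) right_mem_uIcc))]
  refine le_add_of_nonneg_left (intervalIntegral.integral_nonneg hab fun v hv => hP0 v ?_)
  exact ⟨ha.1.trans hv.1, hv.2.trans hb.2⟩

lemma intervalIntegrable_presence [IsFiniteMeasure μ] (hst : s ≤ t)
    (hP : IntervalIntegrable P volume s t) (hP0 : ∀ v ∈ Icc s t, 0 ≤ P v) :
    IntervalIntegrable (presence μ P t) volume s t := by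
  refine MonotoneOn.intervalIntegrable ?_
  rw [uIcc_of_le hst]
  exact monotoneOn_presence hP hP0

lemma integral_presence_anti [IsFiniteMeasure μ] (hst : s ≤ t)
    (hP : IntervalIntegrable P volume s t) (hQ : IntervalIntegrable Q volume s t)
    (hP0 : ∀ v ∈ Icc s t, 0 ≤ P v) (hPQ : ∀ v ∈ Icc s t, P v ≤ Q v) :
    ∫ v in s..t, presence μ Q t v ≤ ∫ v in s..t, presence μ P t v := by
  refine intervalIntegral.integral_mono_on hst
    (intervalIntegrable_presence hst hQ fun v hv => (hP0 v hv).trans (hPQ v hv))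
    (intervalIntegrable_presence hst hP hP0) fun v hv => ?_
  have hsub : uIcc v t ⊆ uIcc s t := uIcc_subset_uIcc (Icc_subset_uIcc hv) right_mem_uIcc
  exact presence_anti hv.2 (hP.mono_set hsub) (hQ.mono_set hsub)
    fun w hw => hPQ w ⟨hv.1.trans hw.1, hw.2⟩

lemma antitone_survival [IsFiniteMeasure μ] (hr : 0 ≤ r) : Antitone (survival μ r) :=
  fun _ _ hvw => measureReal_mono fun _ hx =>
    ⟨(mul_le_mul_of_nonneg_left hvw hr).trans_lt hx.1, hvw.trans hx.2⟩

lemma lintegral_survival [IsFiniteMeasure μ] (hpos : ∀ᵐ x ∂μ, 0 < x.1 ∧ 0 < x.2)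
    (hint : Integrable (fun x => x.2) μ) (hr : 0 ≤ r) :
    ∫⁻ v in Ioi 0, ENNReal.ofReal (survival μ r v) = ENNReal.ofReal (meanSojourn μ r) :=
  calc ∫⁻ v in Ioi 0, ENNReal.ofReal (survival μ r v)
    _ = ∫⁻ v in Ioi 0, μ {x | r * v < x.1 ∧ v ≤ x.2} :=
      lintegral_congr fun _ => ofReal_measureReal
    _ = (volume.restrict (Ioi 0)).prod μ {y | r * y.1 < y.2.1 ∧ y.1 ≤ y.2.2} :=
      (Measure.prod_apply measurableSet_uncharged).symm
    _ = ∫⁻ x, volume.restrict (Ioi 0) {v | r * v < x.1 ∧ v ≤ x.2} ∂μ :=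
      Measure.prod_apply_symm measurableSet_uncharged
    _ = ∫⁻ x, ENNReal.ofReal (sojourn r x) ∂μ :=
      lintegral_congr_ae (hpos.mono fun _ => volume_setOf_uncharged hr)
    _ = ENNReal.ofReal (meanSojourn μ r) :=
      (ofReal_integral_eq_lintegral_ofReal (integrable_sojourn hpos hint)
        (hpos.mono fun _ hx => (sojourn_pos hx).le)).symm

lemma integrableOn_survival [IsFiniteMeasure μ] (hpos : ∀ᵐ x ∂μ, 0 < x.1 ∧ 0 < x.2)
    (hint : Integrable (fun x => x.2) μ) (hr : 0 ≤ r) : IntegrableOn (survival μ r) (Ioi 0) := by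
  refine ⟨(antitone_survival hr).measurable.aestronglyMeasurable, ?_⟩
  rw [hasFiniteIntegral_iff_ofReal (Eventually.of_forall fun _ => survival_nonneg),
    lintegral_survival hpos hint hr]
  exact ENNReal.ofReal_lt_top

lemma integral_Ioi_survival [IsFiniteMeasure μ] (hpos : ∀ᵐ x ∂μ, 0 < x.1 ∧ 0 < x.2)
    (hint : Integrable (fun x => x.2) μ) (hr : 0 ≤ r) :
    ∫ v in Ioi 0, survival μ r v = meanSojourn μ r := by
  rw [integral_eq_lintegral_of_nonneg_ae (Eventually.of_forall fun _ => survival_nonneg)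
    (antitone_survival hr).measurable.aestronglyMeasurable, lintegral_survival hpos hint hr,
    ENNReal.toReal_ofReal]
  exact integral_nonneg_of_ae (hpos.mono fun _ hx => (sojourn_pos hx).le)

lemma tendsto_integral_survival [IsFiniteMeasure μ] (hpos : ∀ᵐ x ∂μ, 0 < x.1 ∧ 0 < x.2)
    (hint : Integrable (fun x => x.2) μ) (hr : 0 ≤ r) (T : ℝ) :
    Tendsto (fun t => ∫ v in 0..t - T, survival μ r v) atTop (𝓝 (meanSojourn μ r)) := by
  rw [← integral_Ioi_survival hpos hint hr]
  exact intervalIntegral_tendsto_integral_Ioi 0 (integrableOn_survival hpos hint hr)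
    (tendsto_atTop_add_const_right _ (-T) tendsto_id)

lemma integral_survival_le_integral_presence [IsFiniteMeasure μ] (hT : 0 ≤ T) (hTt : T ≤ t)
    (hP : IntervalIntegrable P volume 0 t) (hP0 : ∀ v ∈ Icc 0 t, 0 ≤ P v)
    (hPr : ∀ v ∈ Icc T t, P v ≤ r) :
    ∫ v in 0..t - T, survival μ r v ≤ ∫ v in 0..t, presence μ P t v := by
  have hsub : Icc T t ⊆ Icc 0 t := Icc_subset_Icc_left hT
  have hPT : IntervalIntegrable P volume T t :=
    hP.mono_set (by rwa [uIcc_of_le hTt, uIcc_of_le (hT.trans hTt)])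
  calc ∫ v in 0..t - T, survival μ r v
    _ = ∫ v in T..t, presence μ (fun _ => r) t v := integral_presence_const.symm
    _ ≤ ∫ v in T..t, presence μ P t v :=
      integral_presence_anti hTt hPT intervalIntegrable_const (fun v hv => hP0 v (hsub hv)) hPr
    _ ≤ ∫ v in 0..t, presence μ P t v :=
      intervalIntegral.integral_mono_interval hT hTt le_rfl
        (Eventually.of_forall fun _ => presence_nonneg)
        (intervalIntegrable_presence (hT.trans hTt) hP hP0)

-- The vehicles that arrived before `T` are bounded as if they were never charged.
lemma integral_presence_le [IsFiniteMeasure μ] (hT : 0 ≤ T) (hTt : T ≤ t) (hr : 0 ≤ r)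
    (hP : IntervalIntegrable P volume 0 t) (hP0 : ∀ v ∈ Icc 0 t, 0 ≤ P v)
    (hrP : ∀ v ∈ Icc T t, r ≤ P v) :
    ∫ v in 0..t, presence μ P t v ≤
      (∫ v in 0..t, survival μ 0 v) - (∫ v in 0..t - T, survival μ 0 v) +
        ∫ v in 0..t - T, survival μ r v := by
  have ht : 0 ≤ t := hT.trans hTt
  have hmemT : T ∈ uIcc 0 t := Icc_subset_uIcc ⟨hT, hTt⟩
  have hPT : IntervalIntegrable P volume T t := hP.mono_set (uIcc_subset_uIcc hmemT right_mem_uIcc)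
  have hint {Q : ℝ → ℝ} (hQ : IntervalIntegrable Q volume 0 t) (hQ0 : ∀ v ∈ Icc 0 t, 0 ≤ Q v) :
      IntervalIntegrable (presence μ Q t) volume 0 T ∧
        IntervalIntegrable (presence μ Q t) volume T t :=
    have h := intervalIntegrable_presence (μ := μ) ht hQ hQ0
    ⟨h.mono_set (uIcc_subset_uIcc left_mem_uIcc hmemT),
      h.mono_set (uIcc_subset_uIcc hmemT right_mem_uIcc)⟩
  obtain ⟨hpre, hpost⟩ := hint hP hP0
  obtain ⟨hpre0, hpost0⟩ := hint (Q := fun _ => 0) intervalIntegrable_const fun _ _ => le_rfl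
  have hbefore : ∫ v in 0..T, presence μ P t v ≤ ∫ v in 0..T, presence μ (fun _ => 0) t v := by
    refine intervalIntegral.integral_mono_on hT hpre hpre0 fun v hv => ?_
    exact presence_anti (hv.2.trans hTt) intervalIntegrable_const
      (hP.mono_set (uIcc_subset_uIcc (Icc_subset_uIcc ⟨hv.1, hv.2.trans hTt⟩) right_mem_uIcc))
      fun w hw => hP0 w ⟨hv.1.trans hw.1, hw.2⟩
  have hafter : ∫ v in T..t, presence μ P t v ≤ ∫ v in T..t, presence μ (fun _ => r) t v :=
    integral_presence_anti hTt intervalIntegrable_const hPT (fun _ _ => hr) hrP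
  have hsplit := intervalIntegral.integral_add_adjacent_intervals hpre hpost
  have hsplit0 := intervalIntegral.integral_add_adjacent_intervals hpre0 hpost0
  simp only [integral_presence_const, sub_zero] at hafter hsplit0
  linarith

lemma eventually_lt_integral_presence [IsFiniteMeasure μ] (hpos : ∀ᵐ x ∂μ, 0 < x.1 ∧ 0 < x.2)
    (hint : Integrable (fun x => x.2) μ) (hP : ∀ t, 0 ≤ t → IntervalIntegrable P volume 0 t)
    (hP0 : ∀ t, 0 ≤ t → 0 ≤ P t) (hr : 0 ≤ r) (hPr : ∀ᶠ t in atTop, P t ≤ r) {a : ℝ}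
    (ha : a < meanSojourn μ r) : ∀ᶠ t in atTop, a < ∫ s in 0..t, presence μ P t s := by
  obtain ⟨T, hT⟩ := eventually_atTop.1 (hPr.and (eventually_ge_atTop 0))
  have hT0 : 0 ≤ T := (hT T le_rfl).2
  filter_upwards [(tendsto_integral_survival hpos hint hr T).eventually_const_lt ha,
    eventually_ge_atTop T] with t hat hTt
  exact hat.trans_le (integral_survival_le_integral_presence hT0 hTt (hP t (hT0.trans hTt))
    (fun v hv => hP0 v hv.1) fun v hv => (hT v hv.1).1)

lemma eventually_integral_presence_lt [IsFiniteMeasure μ] (hpos : ∀ᵐ x ∂μ, 0 < x.1 ∧ 0 < x.2)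
    (hint : Integrable (fun x => x.2) μ) (hP : ∀ t, 0 ≤ t → IntervalIntegrable P volume 0 t)
    (hP0 : ∀ t, 0 ≤ t → 0 ≤ P t) (hr : 0 ≤ r) (hrP : ∀ᶠ t in atTop, r ≤ P t) {a : ℝ}
    (ha : meanSojourn μ r < a) : ∀ᶠ t in atTop, ∫ s in 0..t, presence μ P t s < a := by
  obtain ⟨T, hT⟩ := eventually_atTop.1 (hrP.and (eventually_ge_atTop 0))
  have hT0 : 0 ≤ T := (hT T le_rfl).2
  have hlim := ((tendsto_integral_survival hpos hint le_rfl 0).sub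
    (tendsto_integral_survival hpos hint le_rfl T)).add (tendsto_integral_survival hpos hint hr T)
  simp only [sub_self, zero_add, sub_zero] at hlim
  filter_upwards [hlim.eventually_lt_const ha, eventually_ge_atTop T] with t hat hTt
  exact (integral_presence_le hT0 hTt hr (hP t (hT0.trans hTt)) (fun v hv => hP0 v hv.1)
    fun v hv => (hT v hv.1).1).trans_lt hat

end Presence

section ExcessLaw

variable {μ : Measure (ℝ × ℝ)} {r t : ℝ}

/-- The equilibrium (excess) law of renewal theory: the law of the residual time in the system, in
stationarity, of a vehicle charged at the constant rate `r`. -/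
def excessLaw (μ : Measure (ℝ × ℝ)) (r : ℝ) : Measure ℝ :=
  (volume.restrict (Ioi 0)).withDensity fun v => ENNReal.ofReal (survival μ r v / meanSojourn μ r)

lemma ae_excessLaw_pos : ∀ᵐ v ∂excessLaw μ r, 0 < v :=
  withDensity_absolutelyContinuous _ _ (ae_restrict_mem measurableSet_Ioi)

lemma excessLaw_real_Ici [IsFiniteMeasure μ] [NeZero μ] (hpos : ∀ᵐ x ∂μ, 0 < x.1 ∧ 0 < x.2)
    (hint : Integrable (fun x => x.2) μ) (hr : 0 ≤ r) (ht : 0 ≤ t) :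
    (excessLaw μ r).real (Ici t) = 1 - (∫ v in 0..t, survival μ r v) / meanSojourn μ r := by
  have hmean : 0 < meanSojourn μ r := meanSojourn_pos hpos hint
  have hdens (v : ℝ) : 0 ≤ survival μ r v / meanSojourn μ r := div_nonneg survival_nonneg hmean.le
  have hIoi := integrableOn_survival hpos hint hr
  have hIoi_t := hIoi.mono_set (Ioi_subset_Ioi ht)
  have hrestrict : (volume.restrict (Ioi 0)).restrict (Ici t) = volume.restrict (Ioi t) := by
    rw [Measure.restrict_restrict measurableSet_Ici, ← Measure.restrict_congr_set
      (Ioi_ae_eq_Ici.inter (ae_eq_refl (Ioi 0))), Ioi_inter_Ioi, max_eq_left ht]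
  have hsplit := intervalIntegral.integral_interval_add_Ioi hIoi hIoi_t
  rw [integral_Ioi_survival hpos hint hr] at hsplit
  rw [measureReal_def, excessLaw, withDensity_apply _ measurableSet_Ici, hrestrict,
    ← ofReal_integral_eq_lintegral_ofReal (hIoi_t.div_const _) (Eventually.of_forall hdens),
    ENNReal.toReal_ofReal (integral_nonneg hdens), integral_div, eq_sub_iff_add_eq, ← add_div,
    add_comm, hsplit, div_self hmean.ne']

lemma meanSojourn_mul_excessLaw_add [IsFiniteMeasure μ] [NeZero μ]
    (hpos : ∀ᵐ x ∂μ, 0 < x.1 ∧ 0 < x.2) (hint : Integrable (fun x => x.2) μ) (hr : 0 ≤ r)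
    (ht : 0 ≤ t) :
    meanSojourn μ r * (excessLaw μ r).real (Ici t) + ∫ v in 0..t, survival μ r v =
      meanSojourn μ r := by
  rw [excessLaw_real_Ici hpos hint hr ht, mul_sub, mul_one,
    mul_div_cancel₀ _ (meanSojourn_pos hpos hint).ne', sub_add_cancel]

lemma isProbabilityMeasure_excessLaw [IsFiniteMeasure μ] [NeZero μ]
    (hpos : ∀ᵐ x ∂μ, 0 < x.1 ∧ 0 < x.2) (hint : Integrable (fun x => x.2) μ) (hr : 0 ≤ r) :
    IsProbabilityMeasure (excessLaw μ r) := by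
  have huniv : (Ici 0 : Set ℝ) =ᵐ[excessLaw μ r] univ :=
    eventuallyEq_univ.2 (ae_excessLaw_pos.mono fun _ => le_of_lt)
  have hreal := excessLaw_real_Ici hpos hint hr le_rfl
  rw [measureReal_congr huniv, intervalIntegral.integral_same, zero_div, sub_zero] at hreal
  exact ⟨(ENNReal.toReal_eq_one_iff _).1 hreal⟩

/-- A law of the charging requirements and parking times of the initial vehicles under which the
vehicles charged at the constant rate `r` have excess-distributed residual times in the system. The
charging requirement is one more than what can be delivered, so that every vehicle leaves because
its parking time expires. -/
def stationaryLaw (μ : Measure (ℝ × ℝ)) (r : ℝ) : Measure (ℝ × ℝ) :=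
  (excessLaw μ r).map fun v => (r * v + 1, v)

lemma isProbabilityMeasure_stationaryLaw [IsFiniteMeasure μ] [NeZero μ]
    (hpos : ∀ᵐ x ∂μ, 0 < x.1 ∧ 0 < x.2) (hint : Integrable (fun x => x.2) μ) (hr : 0 ≤ r) :
    IsProbabilityMeasure (stationaryLaw μ r) :=
  have := isProbabilityMeasure_excessLaw hpos hint hr
  Measure.isProbabilityMeasure_map (by fun_prop)

lemma ae_stationaryLaw_nonneg (hr : 0 ≤ r) : ∀ᵐ x ∂stationaryLaw μ r, 0 ≤ x.1 ∧ 0 ≤ x.2 := by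
  have hmeas : MeasurableSet {x : ℝ × ℝ | 0 ≤ x.1 ∧ 0 ≤ x.2} :=
    (measurableSet_le measurable_const measurable_fst).inter
      (measurableSet_le measurable_const measurable_snd)
  refine (ae_map_iff (by fun_prop) hmeas).2 (ae_excessLaw_pos.mono fun v hv => ?_)
  exact ⟨by positivity, hv.le⟩

lemma stationaryLaw_real_le_snd :
    (stationaryLaw μ r).real {x | t ≤ x.2} = (excessLaw μ r).real (Ici t) :=
  map_measureReal_apply (by fun_prop) (measurableSet_le measurable_const measurable_snd)

lemma survival_stationaryLaw (hr : 0 ≤ r) :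
    survival (stationaryLaw μ r) r t = (excessLaw μ r).real (Ici t) := by
  have hpre : (fun v => (r * v + 1, v)) ⁻¹' {x : ℝ × ℝ | r * t < x.1 ∧ t ≤ x.2} = Ici t := by
    ext v
    refine ⟨And.right, fun htv => ⟨?_, htv⟩⟩
    exact (mul_le_mul_of_nonneg_left htv hr).trans_lt (lt_add_one _)
  have hmeas : MeasurableSet {x : ℝ × ℝ | r * t < x.1 ∧ t ≤ x.2} :=
    (measurableSet_lt measurable_const measurable_fst).inter
      (measurableSet_le measurable_const measurable_snd)
  rw [survival, stationaryLaw, map_measureReal_apply (by fun_prop) hmeas, hpre]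

end ExcessLaw

section LoadFlow

lemma exists_pathSum {ι A : Type*} [AddMonoid A] {parent : ι → Option ι}
    (hwf : WellFounded fun a b => parent b = some a) (c : ι → A) :
    ∃ h : Option ι → A, h none = 0 ∧ ∀ k, h (some k) = h (parent k) + c k := by
  let f : ι → A := hwf.fix fun k rec => (parent k).pelim 0 rec + c k
  refine ⟨fun a => a.elim 0 f, rfl, fun k => ?_⟩
  have hfix : f k = (parent k).pelim 0 (fun a _ => f a) + c k := hwf.fix_eq _ k
  change f k = (parent k).elim 0 f + c k
  rw [hfix, Option.pelim_eq_elim]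

lemma pathSum_nonneg {ι : Type*} {parent : ι → Option ι}
    (hwf : WellFounded fun a b => parent b = some a) {c : ι → ℝ} (hc : ∀ k, 0 ≤ c k)
    {h : Option ι → ℝ} (h0 : h none = 0) (hh : ∀ k, h (some k) = h (parent k) + c k) :
    ∀ a, 0 ≤ h a
  | none => h0.ge
  | some k => by
    induction k using hwf.induction with
    | _ k ih =>
      rw [hh k]
      refine add_nonneg ?_ (hc k)
      cases hk : parent k with
      | none => exact h0.ge
      | some l => exact ih l hk

lemma posSemidef_rank_eq_one_of_sq {a : ℝ} (ha : 0 < a) (b : ℝ) :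
    (!![a ^ 2, a * b; a * b, b ^ 2] : Matrix (Fin 2) (Fin 2) ℝ).PosSemidef ∧
      (!![a ^ 2, a * b; a * b, b ^ 2] : Matrix (Fin 2) (Fin 2) ℝ).rank = 1 := by
  have hmat : (!![a ^ 2, a * b; a * b, b ^ 2] : Matrix (Fin 2) (Fin 2) ℝ) =
      Matrix.vecMulVec ![a, b] (star ![a, b]) := by
    ext i j
    fin_cases i <;> fin_cases j <;> simp [Matrix.vecMulVec_apply] <;> ring
  refine ⟨hmat ▸ Matrix.posSemidef_vecMulVec_self_star _, ?_⟩
  refine le_antisymm (hmat ▸ Matrix.rank_vecMulVec_le _ _) (Nat.one_le_iff_ne_zero.2 fun h0 => ?_)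
  rw [Matrix.rank, Submodule.finrank_eq_zero, LinearMap.range_eq_bot] at h0
  have hentry := congrFun (LinearMap.congr_fun h0 ![1, 0]) 0
  simp [ha.ne'] at hentry

namespace Network

variable {ι J : Type*} [Fintype ι] [Fintype J] (N : Network ι J)

open Classical in
/-- The children of the node `l` in the tree. -/
def children (l : ι) : Finset ι := {c | N.parent c = some l}

variable {N} in
lemma mem_children {l c : ι} : c ∈ N.children l ↔ N.parent c = some l := by
  simp [children]

variable {N} in
lemma mem_subtree {k l : ι} : l ∈ N.subtree k ↔ N.Below k l := by
  simp [subtree]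

lemma self_mem_subtree (k : ι) : k ∈ N.subtree k := mem_subtree.2 .refl

lemma not_below_parent {k l : ι} (hl : N.parent k = some l) : ¬ N.Below k l :=
  fun hkl => N.acyclic.transGen.irrefl.irrefl l (Relation.TransGen.head' hl hkl)

lemma mem_subtreeEdges_iff {k c : ι} :
    c ∈ N.subtreeEdges k ↔ ∃ l ∈ N.subtree k, c ∈ N.children l := by
  simp only [subtreeEdges, Finset.mem_erase, mem_subtree, mem_children]
  constructor
  · rintro ⟨hne, hkc⟩
    exact (Relation.ReflTransGen.cases_tail hkc).resolve_left hne
  · rintro ⟨l, hkl, hlc⟩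
    refine ⟨?_, hkl.tail hlc⟩
    rintro rfl
    exact N.not_below_parent hlc hkl

lemma sum_subtree_sum_children {A : Type*} [AddCommMonoid A] (f : ι → A) (k : ι) :
    ∑ l ∈ N.subtree k, ∑ c ∈ N.children l, f c = ∑ c ∈ N.subtreeEdges k, f c := by
  classical
  rw [← Finset.sum_biUnion]
  · exact Finset.sum_congr (by ext; simp [N.mem_subtreeEdges_iff]) fun _ _ => rfl
  · intro a _ b _ hab
    refine Finset.disjoint_left.2 fun c hca hcb => hab ?_
    exact Option.some.inj ((mem_children.1 hca).symm.trans (mem_children.1 hcb))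

lemma sum_subtree_sub_sum_children {A : Type*} [AddCommGroup A] (f loss : ι → A) (k : ι) :
    ∑ l ∈ N.subtree k, (f l - ∑ c ∈ N.children l, (f c + loss c)) +
      ∑ s ∈ N.subtreeEdges k, loss s = f k := by
  classical
  rw [Finset.sum_sub_distrib, sum_subtree_sum_children, Finset.sum_add_distrib, subtreeEdges,
    ← Finset.sum_erase_add _ _ (N.self_mem_subtree k)]
  abel

lemma exists_sum_children_lt :
    ∃ n : ι → ℝ, (∀ k, 0 < n k) ∧ ∀ l, ∑ c ∈ N.children l, n c < n l := by
  obtain ⟨depth, -, hdepth⟩ := exists_pathSum N.acyclic fun _ => (1 : ℕ)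
  set ρ : ℝ := 1 / (Fintype.card ι + 1) with hρ
  have : 0 < ρ := by positivity
  refine ⟨fun k => ρ ^ depth (some k), fun k => by positivity, fun l => ?_⟩
  calc ∑ c ∈ N.children l, ρ ^ depth (some c)
    _ = ∑ _c ∈ N.children l, ρ ^ depth (some l) * ρ :=
      Finset.sum_congr rfl fun c hc => by rw [hdepth c, mem_children.1 hc, pow_succ]
    _ ≤ Fintype.card ι * (ρ ^ depth (some l) * ρ) := by
      rw [Finset.sum_const, nsmul_eq_mul]
      gcongr
      exact Finset.card_le_univ _
    _ = ρ ^ depth (some l) * (Fintype.card ι / (Fintype.card ι + 1)) := by rw [hρ]; ring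
    _ < ρ ^ depth (some l) :=
      mul_lt_of_lt_one_right (by positivity) ((div_lt_one (by positivity)).2 (lt_add_one _))

variable (V : Option ι → ℝ)

/-- The off-diagonal entries of the edge matrices, when the diagonal entries are the squares of the
(real) voltages `V`. -/
def edgeProd (k : ι) : ℝ := V (N.parent k) * V (some k)

/-- The active power that the voltages `V` push through the edge entering `k`, measured at `k`: the
value of `N.powerP` for which the power flow equation of this edge holds. -/
def edgeFlow (k : ι) : ℝ :=
  (N.edgeProd V k - V (some k) ^ 2 - N.powerQ (V ^ 2) (N.edgeProd V) k * N.X k) / N.R k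

/-- The active power consumed at the node `l` under the voltages `V`, by conservation of power. -/
def nodeLoad (l : ι) : ℝ :=
  N.edgeFlow V l - ∑ c ∈ N.children l, (N.edgeFlow V c + N.lossP (V ^ 2) (N.edgeProd V) c)

variable {V}

lemma acFeasible_of_nodeLoad {L : ι → J → ℝ} (hV0 : V none ^ 2 = N.W₀) (hV : ∀ a, 0 < V a)
    (hVlim : ∀ k, N.vLow k ≤ V (some k) ^ 2 ∧ V (some k) ^ 2 ≤ N.vHigh k)
    (hL : ∀ l, ∑ j, L l j = N.nodeLoad V l) : N.ACFeasible L := by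
  have hrank (k : ι) : (N.edgeMatrix (V ^ 2) (N.edgeProd V) k).PosSemidef ∧
      (N.edgeMatrix (V ^ 2) (N.edgeProd V) k).rank = 1 :=
    posSemidef_rank_eq_one_of_sq (hV (N.parent k)) (V (some k))
  refine ⟨V ^ 2, N.edgeProd V, hV0, hVlim, fun k => ?_, hrank⟩
  have hflow : N.powerP L (V ^ 2) (N.edgeProd V) k = N.edgeFlow V k := by
    simp only [powerP, hL, nodeLoad, sum_subtree_sub_sum_children]
  rw [hflow, edgeFlow, div_mul_cancel₀ _ (N.R_pos k).ne', Pi.pow_apply]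
  ring

-- The voltage drops are of order `ε`, so the losses are of order `ε ^ 2`, and the power flow
-- through the edge `k` is `ε * v * n k` to first order.
lemma exists_nodeLoad_eq {h : Option ι → ℝ} {n : ι → ℝ}
    (hh : ∀ k, h (some k) = h (N.parent k) + N.R k * n k) (v : ℝ) :
    ∃ C : ι → ℝ, ∀ ε l, N.nodeLoad (fun a => v - ε * h a) l =
      ε * (v * (n l - ∑ c ∈ N.children l, n c) - ε * C l) := by
  let heat (s : ι) : ℝ := (N.R s * n s) ^ 2 / (N.R s ^ 2 + N.X s ^ 2)
  let E (k : ι) : ℝ := n k * h (some k) + (∑ s ∈ N.subtreeEdges k, heat s * N.X s) * N.X k / N.R k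
  have hlossP (ε : ℝ) (s : ι) : N.lossP ((fun a => v - ε * h a) ^ 2)
      (N.edgeProd fun a => v - ε * h a) s = ε ^ 2 * (heat s * N.R s) := by
    simp only [lossP, edgeProd, Pi.pow_apply, heat, hh s]; ring
  have hlossQ (ε : ℝ) (s : ι) : N.lossQ ((fun a => v - ε * h a) ^ 2)
      (N.edgeProd fun a => v - ε * h a) s = ε ^ 2 * (heat s * N.X s) := by
    simp only [lossQ, edgeProd, Pi.pow_apply, heat, hh s]; ring
  have hflow (ε : ℝ) (k : ι) :
      N.edgeFlow (fun a => v - ε * h a) k = ε * (v * n k) - ε ^ 2 * E k := by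
    have hR := (N.R_pos k).ne'
    simp only [edgeFlow, powerQ, hlossQ, ← Finset.mul_sum, edgeProd, E]
    field_simp
    rw [hh k]; ring
  refine ⟨fun l => E l - ∑ c ∈ N.children l, (E c - heat c * N.R c), fun ε l => ?_⟩
  simp only [nodeLoad, hflow, hlossP, Finset.sum_add_distrib, Finset.sum_sub_distrib,
    ← Finset.mul_sum]
  ring

variable {N} in
lemma eventually_nodeLoad_mem_Ioo {h : Option ι → ℝ} {n : ι → ℝ}
    (hh : ∀ k, h (some k) = h (N.parent k) + N.R k * n k) (hn : ∀ l, ∑ c ∈ N.children l, n c < n l)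
    {v η : ℝ} (hv : 0 < v) (hη : 0 < η) :
    ∀ᶠ ε in 𝓝[>] (0 : ℝ), ∀ l, N.nodeLoad (fun a => v - ε * h a) l ∈ Ioo 0 η := by
  obtain ⟨C, hC⟩ := N.exists_nodeLoad_eq hh v
  refine eventually_all.2 fun l => ?_
  have hgap : 0 < v * (n l - ∑ c ∈ N.children l, n c) := mul_pos hv (sub_pos.2 (hn l))
  have hslope : Tendsto (fun ε => v * (n l - ∑ c ∈ N.children l, n c) - ε * C l) (𝓝[>] 0)
      (𝓝 (v * (n l - ∑ c ∈ N.children l, n c))) :=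
    tendsto_nhdsWithin_of_tendsto_nhds (Continuous.tendsto' (by fun_prop) _ _ (by ring))
  have hload : Tendsto (fun ε => ε * (v * (n l - ∑ c ∈ N.children l, n c) - ε * C l)) (𝓝[>] 0)
      (𝓝 0) :=
    tendsto_nhdsWithin_of_tendsto_nhds (Continuous.tendsto' (by fun_prop) _ _ (by ring))
  filter_upwards [hslope.eventually_const_lt hgap, hload.eventually_lt_const hη,
    self_mem_nhdsWithin] with ε hpos hlt hε
  rw [hC]
  exact ⟨mul_pos hε hpos, hlt⟩

lemma W₀_pos [Nonempty ι] : 0 < N.W₀ :=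
  (N.vLow_pos (Classical.arbitrary ι)).trans (N.vLow_lt _)

lemma eventually_voltage_pos_and_sq_mem_Icc [Nonempty ι] {h : Option ι → ℝ} (h0 : ∀ a, 0 ≤ h a) :
    ∀ᶠ ε in 𝓝[>] (0 : ℝ), (∀ a, 0 < √N.W₀ - ε * h a) ∧
      ∀ k, (√N.W₀ - ε * h (some k)) ^ 2 ∈ Icc (N.vLow k) N.W₀ := by
  have hlim (a : Option ι) : Tendsto (fun ε => √N.W₀ - ε * h a) (𝓝[>] 0) (𝓝 √N.W₀) :=
    tendsto_nhdsWithin_of_tendsto_nhds (Continuous.tendsto' (by fun_prop) _ _ (by ring))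
  have hsq : √N.W₀ ^ 2 = N.W₀ := Real.sq_sqrt N.W₀_pos.le
  have hpos : ∀ᶠ ε in 𝓝[>] (0 : ℝ), ∀ a, 0 < √N.W₀ - ε * h a :=
    eventually_all.2 fun a => (hlim a).eventually_const_lt (Real.sqrt_pos.2 N.W₀_pos)
  have hlow : ∀ᶠ ε in 𝓝[>] (0 : ℝ), ∀ k, N.vLow k < (√N.W₀ - ε * h (some k)) ^ 2 :=
    eventually_all.2 fun k => ((hlim k).pow 2).eventually_const_lt ((N.vLow_lt k).trans_eq hsq.symm)
  filter_upwards [hpos, hlow, self_mem_nhdsWithin] with ε hεpos hεlow hε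
  refine ⟨hεpos, fun k => ⟨(hεlow k).le, ?_⟩⟩
  calc (√N.W₀ - ε * h (some k)) ^ 2
    _ ≤ √N.W₀ ^ 2 :=
      pow_le_pow_left₀ (hεpos k).le (sub_le_self _ (mul_nonneg (le_of_lt hε) (h0 k))) 2
    _ = N.W₀ := hsq

lemma exists_pos_acFeasible [Nonempty ι] [Nonempty J] {η : ℝ} (hη : 0 < η) :
    ∃ L : ι → J → ℝ, (∀ i j, 0 < L i j ∧ L i j ≤ η) ∧ N.ACFeasible L := by
  obtain ⟨n, hn0, hn⟩ := N.exists_sum_children_lt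
  obtain ⟨h, h0, hh⟩ := exists_pathSum N.acyclic fun k => N.R k * n k
  have hh0 := pathSum_nonneg N.acyclic (fun k => (mul_pos (N.R_pos k) (hn0 k)).le) h0 hh
  have hcard : 0 < (Fintype.card J : ℝ) := by exact_mod_cast Fintype.card_pos
  obtain ⟨ε, hload, hpos, hlim⟩ := ((eventually_nodeLoad_mem_Ioo hh hn
    (Real.sqrt_pos.2 N.W₀_pos) (mul_pos hcard hη)).and
      (N.eventually_voltage_pos_and_sq_mem_Icc hh0)).exists
  refine ⟨fun l _ => N.nodeLoad (fun a => √N.W₀ - ε * h a) l / Fintype.card J,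
    fun i _ => ⟨div_pos (hload i).1 hcard, (div_le_iff₀' hcard).2 (hload i).2.le⟩,
    N.acFeasible_of_nodeLoad ?_ hpos (fun k => ⟨(hlim k).1, (hlim k).2.trans (N.le_vHigh k)⟩) ?_⟩
  · simp [h0, Real.sq_sqrt N.W₀_pos.le]
  · intro l
    rw [Finset.sum_const, nsmul_eq_mul, Finset.card_univ, mul_div_cancel₀ _ hcard.ne']

lemma exists_pos_linFeasible {η : ℝ} (hη : 0 < η) :
    ∃ L : ι → J → ℝ, (∀ i j, 0 < L i j ∧ L i j ≤ η) ∧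
      ∀ k, N.vLow k ≤ N.Wlin L k ∧ N.Wlin L k ≤ N.vHigh k := by
  have hlow : ∀ᶠ ε in 𝓝[>] (0 : ℝ), ∀ k, N.vLow k < N.Wlin (fun _ (_ : J) => ε) k := by
    refine eventually_all.2 fun k => ?_
    have hlim : Tendsto (fun ε : ℝ => N.Wlin (fun _ (_ : J) => ε) k) (𝓝[>] 0) (𝓝 N.W₀) := by
      refine tendsto_nhdsWithin_of_tendsto_nhds ?_
      unfold Wlin
      exact Continuous.tendsto' (by fun_prop) _ _ (by simp)
    exact hlim.eventually_const_lt (N.vLow_lt k)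
  obtain ⟨ε, hεlow, hε0, hεη⟩ := (hlow.and (Ioo_mem_nhdsGT hη)).exists
  refine ⟨fun _ _ => ε, fun _ _ => ⟨hε0, hεη.le⟩, fun k => ⟨(hεlow k).le, ?_⟩⟩
  refine (sub_le_self _ ?_).trans (N.le_vHigh k)
  refine mul_nonneg zero_le_two (Finset.sum_nonneg fun s _ => mul_nonneg (N.R_pos s).le ?_)
  exact Finset.sum_nonneg fun _ _ => Finset.sum_nonneg fun _ _ => hε0.le

lemma exists_pos_voltageFeasible [Nonempty ι] [Nonempty J] (m : FlowModel) {η : ℝ} (hη : 0 < η) :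
    ∃ L : ι → J → ℝ, (∀ i j, 0 < L i j ∧ L i j ≤ η) ∧ N.VoltageFeasible m L := by
  cases m with
  | ac => exact N.exists_pos_acFeasible hη
  | linDistflow => exact N.exists_pos_linFeasible hη

variable {N} in
lemma feasible_div_of_load {m : FlowModel} {z L : ι → J → ℝ} (hz : ∀ i j, 0 < z i j)
    (hL0 : ∀ i j, 0 ≤ L i j) (hLM : ∀ i, ∑ j, L i j ≤ N.M i)
    (hLc : ∀ i j, L i j ≤ z i j * N.cmax j) (hLv : N.VoltageFeasible m L) :
    N.Feasible m z fun i j => L i j / z i j := by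
  have hload (i : ι) (j : J) : z i j * (L i j / z i j) = L i j := mul_div_cancel₀ _ (hz i j).ne'
  refine ⟨fun i => ?_, fun i j => ⟨div_nonneg (hL0 i j) (hz i j).le, ?_⟩, ?_⟩
  · simpa only [hload] using hLM i
  · exact (div_le_iff₀' (hz i j)).2 (hLc i j)
  · simpa only [hload] using hLv

lemma exists_pos_feasible [Nonempty ι] [Nonempty J] (m : FlowModel) {z : ι → J → ℝ}
    (hz : ∀ i j, 0 < z i j) : ∃ q, (∀ i j, 0 < q i j) ∧ N.Feasible m z q := by
  have hcard : 0 < (Fintype.card J : ℝ) := by exact_mod_cast Fintype.card_pos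
  have hM : ∀ᶠ η in 𝓝[>] (0 : ℝ), ∀ i, η < N.M i / Fintype.card J :=
    eventually_all.2 fun i => mem_of_superset (Ioo_mem_nhdsGT (div_pos (N.M_pos i) hcard))
      fun _ hη => hη.2
  have hc : ∀ᶠ η in 𝓝[>] (0 : ℝ), ∀ i j, η < z i j * N.cmax j :=
    eventually_all.2 fun i => eventually_all.2 fun j => mem_of_superset
      (Ioo_mem_nhdsGT (mul_pos (hz i j) (N.cmax_pos j))) fun _ hη => hη.2
  obtain ⟨η, hηM, hηc, hη⟩ := (hM.and (hc.and self_mem_nhdsWithin)).exists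
  obtain ⟨L, hL, hLv⟩ := N.exists_pos_voltageFeasible m hη
  refine ⟨fun i j => L i j / z i j, fun i j => div_pos (hL i j).1 (hz i j),
    feasible_div_of_load hz (fun i j => (hL i j).1.le) (fun i => ?_)
      (fun i j => (hL i j).2.trans (hηc i j).le) hLv⟩
  calc ∑ j, L i j
    _ ≤ ∑ _j : J, η := Finset.sum_le_sum fun j _ => (hL i j).2
    _ = Fintype.card J * η := by simp
    _ ≤ N.M i := ((lt_div_iff₀' hcard).1 (hηM i)).le

end Network

end LoadFlow

section Allocation

namespace IsUtility

variable {u : ℝ → EReal} {x y : ℝ}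

lemma ne_top (hu : IsUtility u) (hx : 0 ≤ x) : u x ≠ ⊤ :=
  ((hu.strictMono hx (hx.trans (le_add_of_nonneg_right zero_le_one)) (lt_add_one x)).trans_le
    le_top).ne

lemma ne_bot_of_le (hu : IsUtility u) (hx : 0 ≤ x) (hxy : x ≤ y) (hbot : u x ≠ ⊥) : u y ≠ ⊥ :=
  ne_bot_of_le_ne_bot hbot (hu.strictMono.monotoneOn hx (hx.trans hxy) hxy)

lemma ne_bot_mul (hu : IsUtility u) (hx : 0 ≤ x) (hbot : u x ≠ ⊥) {θ : ℝ} (hθ : 0 < θ) :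
    u (θ * x) ≠ ⊥ := by
  rcases hx.eq_or_lt with rfl | hx
  · rwa [mul_zero]
  · exact (hu.finite _ (mul_pos hθ hx)).1

lemma strictMonoOn_toReal (hu : IsUtility u) :
    StrictMonoOn (fun x => (u x).toReal) {x | 0 ≤ x ∧ u x ≠ ⊥} := by
  rintro x ⟨hx, hxbot⟩ y ⟨hy, hybot⟩ hxy
  rw [← EReal.coe_lt_coe_iff, EReal.coe_toReal (hu.ne_top hx) hxbot,
    EReal.coe_toReal (hu.ne_top hy) hybot]
  exact hu.strictMono hx hy hxy

lemma tendsto_toReal_mul (hu : IsUtility u) (hx : 0 ≤ x) :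
    Tendsto (fun θ => (u (θ * x)).toReal) (𝓝[<] 1) (𝓝 (u x).toReal) := by
  rcases hx.eq_or_lt with rfl | hx
  · simpa only [mul_zero] using tendsto_const_nhds
  have hcont : ContinuousAt (fun y => (u y).toReal) x :=
    (hu.differentiable.differentiableAt (Ioi_mem_nhds hx)).continuousAt
  have hmul : Tendsto (fun θ => θ * x) (𝓝[<] 1) (𝓝 x) :=
    tendsto_nhdsWithin_of_tendsto_nhds (Continuous.tendsto' (by fun_prop) _ _ (one_mul x))
  exact hcont.tendsto.comp hmul

end IsUtility

lemma ereal_ne_bot_of_sum_ne_bot {α : Type*} {s : Finset α} {f : α → EReal}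
    (h : ∑ a ∈ s, f a ≠ ⊥) {a : α} (ha : a ∈ s) : f a ≠ ⊥ := by
  classical
  intro hfa
  rw [← Finset.add_sum_erase s f ha, hfa, EReal.bot_add] at h
  exact h rfl

lemma ereal_coe_sum {α : Type*} (s : Finset α) (f : α → ℝ) :
    ((∑ a ∈ s, f a : ℝ) : EReal) = ∑ a ∈ s, (f a : EReal) :=
  map_sum (⟨⟨Real.toEReal, EReal.coe_zero⟩, EReal.coe_add⟩ : ℝ →+ EReal) f s

namespace Network

variable {ι J : Type*} [Fintype ι] [Fintype J] (N : Network ι J)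

/-- The total utility of the rates `q` in state `z` as a real number. It agrees with
`N.objective z q` only if no utility is `-∞`. -/
def welfare (z q : ι → J → ℝ) : ℝ := ∑ i, ∑ j, z i j * (N.u i j (q i j)).toReal

variable {N} {m : FlowModel} {p : (ι → J → ℝ) → ι → J → ℝ} {y z w q b : ι → J → ℝ}

lemma objective_eq_welfare (hq : 0 ≤ q) (hbot : ∀ i j, N.u i j (q i j) ≠ ⊥) :
    N.objective z q = N.welfare z q := by
  simp only [objective, welfare, ereal_coe_sum, EReal.coe_mul,
    EReal.coe_toReal ((N.u_utility _ _).ne_top (hq _ _)) (hbot _ _)]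

lemma objective_mono (hz : 0 ≤ z) (hq : 0 ≤ q) (hqb : q ≤ b) :
    N.objective z q ≤ N.objective z b :=
  Finset.sum_le_sum fun i _ => Finset.sum_le_sum fun j _ => mul_le_mul_of_nonneg_left
    ((N.u_utility i j).strictMono.monotoneOn (hq i j) ((hq i j).trans (hqb i j)) (hqb i j))
    (EReal.coe_nonneg.2 (hz i j))

lemma welfare_smul (c : ℝ) : N.welfare (c • z) q = c * N.welfare z q := by
  simp only [welfare, Pi.smul_apply, smul_eq_mul, mul_assoc, Finset.mul_sum]

lemma tendsto_welfare_smul (hq : 0 ≤ q) :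
    Tendsto (fun θ : ℝ => N.welfare z (θ • q)) (𝓝[<] 1) (𝓝 (N.welfare z q)) :=
  tendsto_finsetSum _ fun i _ => tendsto_finsetSum _ fun j _ =>
    ((N.u_utility i j).tendsto_toReal_mul (hq i j)).const_mul _

lemma eq_of_welfare_le (hz : ∀ i j, 0 < z i j) (hb : 0 ≤ b) (hbot : ∀ i j, N.u i j (b i j) ≠ ⊥)
    (hbq : b ≤ q) (hle : N.welfare z q ≤ N.welfare z b) : q = b := by
  have hmem (i j) : b i j ∈ {x | 0 ≤ x ∧ N.u i j x ≠ ⊥} := ⟨hb i j, hbot i j⟩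
  have hmem' (i j) : q i j ∈ {x | 0 ≤ x ∧ N.u i j x ≠ ⊥} :=
    ⟨(hb i j).trans (hbq i j), (N.u_utility i j).ne_bot_of_le (hb i j) (hbq i j) (hbot i j)⟩
  have hterm (i j) : z i j * (N.u i j (b i j)).toReal ≤ z i j * (N.u i j (q i j)).toReal :=
    mul_le_mul_of_nonneg_left ((N.u_utility i j).strictMonoOn_toReal.monotoneOn (hmem i j)
      (hmem' i j) (hbq i j)) (hz i j).le
  by_contra hne
  obtain ⟨i, j, hij⟩ : ∃ i j, q i j ≠ b i j := by
    simpa only [ne_eq, funext_iff, not_forall] using hne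
  have hlt : z i j * (N.u i j (b i j)).toReal < z i j * (N.u i j (q i j)).toReal :=
    mul_lt_mul_of_pos_left ((N.u_utility i j).strictMonoOn_toReal (hmem i j) (hmem' i j)
      ((hbq i j).lt_of_ne' hij)) (hz i j)
  refine hle.not_gt (Finset.sum_lt_sum (fun i _ => Finset.sum_le_sum fun j _ => hterm i j)
    ⟨i, Finset.mem_univ i, Finset.sum_lt_sum (fun j _ => hterm i j) ⟨j, Finset.mem_univ j, hlt⟩⟩)

lemma eq_of_forall_welfare_smul_le (hz : ∀ i j, 0 < z i j) (hb : 0 ≤ b)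
    (hbot : ∀ i j, N.u i j (b i j) ≠ ⊥) (hbq : b ≤ q)
    (hle : ∀ θ ∈ Ioo (0 : ℝ) 1, N.welfare z (θ • q) ≤ N.welfare z b) : q = b :=
  eq_of_welfare_le hz hb hbot hbq (le_of_tendsto (tendsto_welfare_smul (hb.trans hbq))
    (mem_of_superset (Ioo_mem_nhdsLT one_pos) hle))

namespace IsAllocation

lemma nonneg (hp : N.IsAllocation m p) (hz : 0 ≤ z) : 0 ≤ p z := fun i j => ((hp z hz).1.2.1 i j).1

lemma le_cmax (hp : N.IsAllocation m p) (hz : 0 ≤ z) (i : ι) (j : J) : p z i j ≤ N.cmax j :=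
  ((hp z hz).1.2.1 i j).2

lemma utility_ne_bot (hp : N.IsAllocation m p) (hz : ∀ i j, 0 < z i j) (i : ι) (j : J) :
    N.u i j (p z i j) ≠ ⊥ := by
  have : Nonempty ι := ⟨i⟩
  have : Nonempty J := ⟨j⟩
  obtain ⟨q, hq, hqf⟩ := N.exists_pos_feasible m hz
  have hopt := (hp z fun i j => (hz i j).le).2.1 q hqf
  rw [objective_eq_welfare (fun i j => (hq i j).le)
    fun i j => ((N.u_utility i j).finite _ (hq i j)).1] at hopt
  have hbot : N.objective z (p z) ≠ ⊥ := ((EReal.bot_lt_coe _).trans_le hopt).ne'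
  have hij := ereal_ne_bot_of_sum_ne_bot
    (ereal_ne_bot_of_sum_ne_bot hbot (Finset.mem_univ i)) (Finset.mem_univ j)
  contrapose! hij
  rw [hij, EReal.coe_mul_bot_of_pos (hz i j)]

lemma feasible_of_le (hp : N.IsAllocation m p) (hy : ∀ i j, 0 < y i j) (hyw : y ≤ w) :
    N.Feasible m w fun i j => y i j * p y i j / w i j := by
  obtain ⟨hM, hc, hv⟩ := (hp y fun i j => (hy i j).le).1
  exact feasible_div_of_load (fun i j => (hy i j).trans_le (hyw i j))
    (fun i j => mul_nonneg (hy i j).le (hc i j).1) hM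
    (fun i j => mul_le_mul (hyw i j) (hc i j).2 (hc i j).1 ((hy i j).le.trans (hyw i j))) hv

lemma welfare_le (hp : N.IsAllocation m p) (hy : ∀ i j, 0 < y i j) (hyw : y ≤ w) (hq : 0 ≤ q)
    (hbot : ∀ i j, N.u i j (q i j) ≠ ⊥) (hload : ∀ i j, w i j * q i j ≤ y i j * p y i j)
    (hb : p w ≤ b) : N.welfare w q ≤ N.welfare w b := by
  have hw (i j) : 0 < w i j := (hy i j).trans_le (hyw i j)
  have hw0 : 0 ≤ w := fun i j => (hw i j).le
  have hpw := hp.nonneg hw0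
  rw [← EReal.coe_le_coe_iff, ← objective_eq_welfare hq hbot, ← objective_eq_welfare (hpw.trans hb)
    fun i j => (N.u_utility i j).ne_bot_of_le (hpw i j) (hb i j) (hp.utility_ne_bot hw i j)]
  calc N.objective w q
    _ ≤ N.objective w fun i j => y i j * p y i j / w i j :=
      objective_mono hw0 hq fun i j => (le_div_iff₀' (hw i j)).2 (hload i j)
    _ ≤ N.objective w (p w) := (hp w hw0).2.1 _ (hp.feasible_of_le hy hyw)
    _ ≤ N.objective w b := objective_mono hw0 hpw hb

lemma load_eq_of_le (hp : N.IsAllocation m p) (hy : ∀ i j, 0 < y i j) (hyw : y ≤ w)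
    (hload : ∀ i j, w i j * p w i j ≤ y i j * p y i j) (i : ι) (j : J) :
    w i j * p w i j = y i j * p y i j := by
  have hw (i j) : 0 < w i j := (hy i j).trans_le (hyw i j)
  have hpw := hp.nonneg fun i j => (hw i j).le
  have hpq : p w ≤ fun i j => y i j * p y i j / w i j :=
    fun i j => (le_div_iff₀' (hw i j)).2 (hload i j)
  have hbot := hp.utility_ne_bot hw
  have heq := eq_of_welfare_le hw hpw hbot hpq (hp.welfare_le hy hyw (hpw.trans hpq)
    (fun i j => (N.u_utility i j).ne_bot_of_le (hpw i j) (hpq i j) (hbot i j))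
    (fun i j => (mul_div_cancel₀ _ (hw i j).ne').le) le_rfl)
  rw [← congrFun₂ heq i j, mul_div_cancel₀ _ (hw i j).ne']

lemma iInf_rate_smul (hp : N.IsAllocation m p) (hmono : IsMonotone p) (hy : ∀ i j, 0 < y i j)
    (i : ι) (j : J) : ⨅ θ : Ioo (0 : ℝ) 1, p (θ.1 • y) i j = p y i j := by
  have hpos (θ : Ioo (0 : ℝ) 1) (i j) : 0 < (θ.1 • y) i j := mul_pos θ.2.1 (hy i j)
  have hle (θ : Ioo (0 : ℝ) 1) : θ.1 • y ≤ y :=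
    fun i j => mul_le_of_le_one_left (hy i j).le θ.2.2.le
  have : Nonempty (Ioo (0 : ℝ) 1) := nonempty_Ioo_subtype one_pos
  have hlb (i j) (θ : Ioo (0 : ℝ) 1) : p y i j ≤ p (θ.1 • y) i j := hmono _ _ (hpos θ) (hle θ) i j
  have hpy := hp.nonneg fun i j => (hy i j).le
  have hbot := hp.utility_ne_bot hy
  set L : ι → J → ℝ := fun i j => ⨅ θ : Ioo (0 : ℝ) 1, p (θ.1 • y) i j
  have hL : p y ≤ L := fun i j => le_ciInf (hlb i j)
  have hLbot (i j) : N.u i j (L i j) ≠ ⊥ :=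
    (N.u_utility i j).ne_bot_of_le (hpy i j) (hL i j) (hbot i j)
  refine congrFun₂ (eq_of_forall_welfare_smul_le hy hpy hbot hL fun θ hθ => ?_) i j
  refine hp.welfare_le (hpos ⟨θ, hθ⟩) (hle ⟨θ, hθ⟩) (smul_nonneg hθ.1.le (hpy.trans hL))
    (fun i j => (N.u_utility i j).ne_bot_mul ((hpy i j).trans (hL i j)) (hLbot i j) hθ.1)
    (fun i j => ?_) le_rfl
  calc y i j * (θ * L i j)
    _ = θ * y i j * L i j := by ring
    _ ≤ θ * y i j * p (θ • y) i j := mul_le_mul_of_nonneg_left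
      (ciInf_le ⟨p y i j, forall_mem_range.2 (hlb i j)⟩ ⟨θ, hθ⟩) (hpos ⟨θ, hθ⟩ i j).le

lemma iSup_rate_inv_smul (hp : N.IsAllocation m p) (hmono : IsMonotone p) (hy : ∀ i j, 0 < y i j)
    (i : ι) (j : J) : ⨆ θ : Ioo (0 : ℝ) 1, p (θ.1⁻¹ • y) i j = p y i j := by
  have hle (θ : Ioo (0 : ℝ) 1) : y ≤ θ.1⁻¹ • y :=
    fun i j => le_mul_of_one_le_left (hy i j).le ((one_le_inv₀ θ.2.1).2 θ.2.2.le)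
  have hpos (θ : Ioo (0 : ℝ) 1) (i j) : 0 < (θ.1⁻¹ • y) i j := (hy i j).trans_le (hle θ i j)
  have hub (i j) (θ : Ioo (0 : ℝ) 1) : p (θ.1⁻¹ • y) i j ≤ p y i j := hmono _ _ hy (hle θ) i j
  have : Nonempty (Ioo (0 : ℝ) 1) := nonempty_Ioo_subtype one_pos
  let θ₀ := Classical.arbitrary (Ioo (0 : ℝ) 1)
  have hpy := hp.nonneg fun i j => (hy i j).le
  set L : ι → J → ℝ := fun i j => ⨆ θ : Ioo (0 : ℝ) 1, p (θ.1⁻¹ • y) i j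
  have hL (θ : Ioo (0 : ℝ) 1) : p (θ.1⁻¹ • y) ≤ L :=
    fun i j => le_ciSup (f := fun θ : Ioo (0 : ℝ) 1 => p (θ.1⁻¹ • y) i j)
      ⟨p y i j, forall_mem_range.2 (hub i j)⟩ θ
  have hp₀ := hp.nonneg fun i j => (hpos θ₀ i j).le
  have hLbot (i j) : N.u i j (L i j) ≠ ⊥ :=
    (N.u_utility i j).ne_bot_of_le (hp₀ i j) (hL θ₀ i j) (hp.utility_ne_bot (hpos θ₀) i j)
  have hLp : L ≤ p y := fun i j => ciSup_le (hub i j)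
  refine (congrFun₂ (eq_of_forall_welfare_smul_le hy (hp₀.trans (hL θ₀)) hLbot hLp
    fun θ hθ => ?_) i j).symm
  have hwelfare := hp.welfare_le hy (hle ⟨θ, hθ⟩) (smul_nonneg hθ.1.le hpy)
    (fun i j => (N.u_utility i j).ne_bot_mul (hpy i j) (hp.utility_ne_bot hy i j) hθ.1)
    (fun i j => (mul_mul_mul_comm θ⁻¹ (y i j) θ (p y i j)).trans_le (by simp [hθ.1.ne']))
    (hL ⟨θ, hθ⟩)
  rw [welfare_smul, welfare_smul] at hwelfare
  exact le_of_mul_le_mul_left hwelfare (inv_pos.2 hθ.1)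

lemma continuousAt (hp : N.IsAllocation m p) (hmono : IsMonotone p) (hy : ∀ i j, 0 < y i j) :
    ContinuousAt p y := by
  have hgt {a : ι → J → ℝ} (ha : ∀ i j, a i j < y i j) : ∀ᶠ y' in 𝓝 y, ∀ i j, a i j < y' i j :=
    eventually_all.2 fun i => eventually_all.2 fun j =>
      (continuous_apply_apply i j).continuousAt.eventually_const_lt (ha i j)
  have hlt {a : ι → J → ℝ} (ha : ∀ i j, y i j < a i j) : ∀ᶠ y' in 𝓝 y, ∀ i j, y' i j < a i j :=
    eventually_all.2 fun i => eventually_all.2 fun j =>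
      (continuous_apply_apply i j).continuousAt.eventually_lt_const (ha i j)
  have : Nonempty (Ioo (0 : ℝ) 1) := nonempty_Ioo_subtype one_pos
  refine tendsto_pi_nhds.2 fun i => tendsto_pi_nhds.2 fun j => tendsto_order.2 ⟨?_, ?_⟩
  · intro c hc
    rw [← hp.iSup_rate_inv_smul hmono hy] at hc
    obtain ⟨θ, hθ⟩ := exists_lt_of_lt_ciSup hc
    filter_upwards [hgt hy, hlt fun i j => lt_mul_of_one_lt_left (hy i j)
      ((one_lt_inv₀ θ.2.1).2 θ.2.2)] with y' hy' hy'θ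
    exact hθ.trans_le (hmono _ _ hy' (fun i j => (hy'θ i j).le) i j)
  · intro c hc
    rw [← hp.iInf_rate_smul hmono hy] at hc
    obtain ⟨θ, hθ⟩ := exists_lt_of_ciInf_lt hc
    filter_upwards [hgt fun i j => mul_lt_of_lt_one_left (hy i j) θ.2.2] with y' hy'θ
    exact (hmono _ _ (fun i j => mul_pos θ.2.1 (hy i j)) (fun i j => (hy'θ i j).le) i j).trans_lt hθ

end IsAllocation
end Network

end Allocation

section MeanPopulation

lemma exists_isFixedPt_of_monotoneOn_Icc {α : Type*} [ConditionallyCompleteLattice α] {a b : α}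
    (hab : a ≤ b) {f : α → α} (hf : MonotoneOn f (Icc a b)) (hmaps : MapsTo f (Icc a b) (Icc a b)) :
    ∃ x ∈ Icc a b, Function.IsFixedPt f x := by
  have : Fact (a ≤ b) := ⟨hab⟩
  let g : Icc a b →o Icc a b := ⟨hmaps.restrict, fun x y hxy => hf x.2 y.2 hxy⟩
  exact ⟨g.lfp, g.lfp.2, congrArg Subtype.val g.isFixedPt_lfp⟩

namespace Network

variable {ι J : Type*} [Fintype ι] [Fintype J] (N : Network ι J)

instance (j : J) : IsProbabilityMeasure (N.F j) := N.F_prob j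

/-- The mean stationary populations when the vehicles are charged at the constant rates `p y`,
by Little's law. -/
def meanPopulation (p : (ι → J → ℝ) → ι → J → ℝ) (y : ι → J → ℝ) : ι → J → ℝ :=
  fun i j => N.lam i j * meanSojourn (N.F j) (p y i j)

variable {p : (ι → J → ℝ) → ι → J → ℝ}

lemma lam_mul_meanSojourn_pos (i : ι) (j : J) (r : ℝ) : 0 < N.lam i j * meanSojourn (N.F j) r :=
  mul_pos (N.lam_pos i j) (meanSojourn_pos (N.F_pos j) (N.F_mean j))

lemma lam_mul_meanSojourn_anti (i : ι) (j : J) {r s : ℝ} (hrs : r ≤ s) :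
    N.lam i j * meanSojourn (N.F j) s ≤ N.lam i j * meanSojourn (N.F j) r :=
  mul_le_mul_of_nonneg_left (antitone_meanSojourn (N.F_pos j) (N.F_mean j) hrs) (N.lam_pos i j).le

variable {N} {m : FlowModel} {y w y₁ y₂ : ι → J → ℝ}

lemma meanPopulation_mono (hmono : IsMonotone p) (hy : ∀ i j, 0 < y i j) (hyw : y ≤ w) :
    N.meanPopulation p y ≤ N.meanPopulation p w :=
  fun i j => N.lam_mul_meanSojourn_anti i j (hmono y w hy hyw i j)

lemma IsAllocation.continuousAt_meanPopulation (hp : N.IsAllocation m p) (hmono : IsMonotone p)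
    (hy : ∀ i j, 0 < y i j) : ContinuousAt (N.meanPopulation p) y :=
  continuousAt_pi.2 fun i => continuousAt_pi.2 fun j => continuousAt_const.mul
    ((continuous_meanSojourn (N.F_pos j) (N.F_mean j)).continuousAt.comp
      ((continuous_apply_apply i j).continuousAt.comp (hp.continuousAt hmono hy)))

lemma IsAllocation.tendsto_meanPopulation_smul (hp : N.IsAllocation m p) (hmono : IsMonotone p)
    (hy : ∀ i j, 0 < y i j) :
    Tendsto (fun θ : ℝ => N.meanPopulation p (θ • y)) (𝓝 1) (𝓝 (N.meanPopulation p y)) :=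
  (hp.continuousAt_meanPopulation hmono hy).tendsto.comp
    (Continuous.tendsto' (by fun_prop) _ _ (one_smul ℝ y))

lemma eq_of_meanPopulation_le_of_le_meanPopulation (hp : N.IsAllocation m p) (hmono : IsMonotone p)
    (hinf : ∀ j, N.infRatio j ≤ 1 / N.cmax j) (hy : ∀ i j, 0 < y i j) (hyw : y ≤ w)
    (hPhi_y : N.meanPopulation p y ≤ y) (hPhi_w : w ≤ N.meanPopulation p w) : y = w := by
  have hw (i j) : 0 < w i j := (hy i j).trans_le (hyw i j)
  have hpy_mem (i j) : p y i j ∈ Icc 0 (N.cmax j) :=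
    (hp y fun i j => (hy i j).le).1.2.1 i j
  have hpw_mem (i j) : p w i j ∈ Icc 0 (N.cmax j) :=
    (hp w fun i j => (hw i j).le).1.2.1 i j
  have hstrict (j) := strictMonoOn_mul_meanSojourn (N.F_pos j) (N.F_mean j) (hinf j)
  have hload_w (i j) : w i j * p w i j ≤ N.lam i j * (p w i j * meanSojourn (N.F j) (p w i j)) :=
    (mul_le_mul_of_nonneg_right (hPhi_w i j) (hpw_mem i j).1).trans_eq (by
      rw [meanPopulation, mul_assoc, mul_comm (meanSojourn _ _)])
  have hload_y (i j) : N.lam i j * (p y i j * meanSojourn (N.F j) (p y i j)) ≤ y i j * p y i j :=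
    (mul_le_mul_of_nonneg_right (hPhi_y i j) (hpy_mem i j).1).trans_eq' (by
      rw [meanPopulation, mul_assoc, mul_comm (meanSojourn _ _)])
  have hmiddle (i j) : N.lam i j * (p w i j * meanSojourn (N.F j) (p w i j)) ≤
      N.lam i j * (p y i j * meanSojourn (N.F j) (p y i j)) :=
    mul_le_mul_of_nonneg_left ((hstrict j).monotoneOn (hpw_mem i j) (hpy_mem i j)
      (hmono y w hy hyw i j)) (N.lam_pos i j).le
  have hload := hp.load_eq_of_le hy hyw fun i j =>
    (hload_w i j).trans ((hmiddle i j).trans (hload_y i j))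
  have hrate : p w = p y := by
    funext i j
    refine (hstrict j).injOn (hpw_mem i j) (hpy_mem i j) ?_
    refine mul_left_cancel₀ (N.lam_pos i j).ne' ((hmiddle i j).antisymm ?_)
    exact (hload_y i j).trans ((hload i j).symm.le.trans (hload_w i j))
  have hPhi : N.meanPopulation p w = N.meanPopulation p y := by
    unfold meanPopulation
    rw [hrate]
  exact hyw.antisymm (hPhi_w.trans (hPhi.trans_le hPhi_y))

lemma pos_of_isFixedPt (hy : Function.IsFixedPt (N.meanPopulation p) y) (i : ι) (j : J) :
    0 < y i j := by
  rw [← hy]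
  exact N.lam_mul_meanSojourn_pos i j _

lemma isFixedPt_meanPopulation_unique (hp : N.IsAllocation m p) (hmono : IsMonotone p)
    (hinf : ∀ j, N.infRatio j ≤ 1 / N.cmax j) (h₁ : Function.IsFixedPt (N.meanPopulation p) y₁)
    (h₂ : Function.IsFixedPt (N.meanPopulation p) y₂) : y₁ = y₂ := by
  have hpos (i j) : 0 < (y₁ ⊓ y₂) i j := lt_min (pos_of_isFixedPt h₁ i j) (pos_of_isFixedPt h₂ i j)
  refine inf_eq_sup.1 (eq_of_meanPopulation_le_of_le_meanPopulation hp hmono hinf hpos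
    inf_le_sup (le_inf ?_ ?_) (sup_le ?_ ?_))
  · exact (meanPopulation_mono hmono hpos inf_le_left).trans_eq h₁
  · exact (meanPopulation_mono hmono hpos inf_le_right).trans_eq h₂
  · exact h₁.symm.trans_le (meanPopulation_mono hmono (pos_of_isFixedPt h₁) le_sup_left)
  · exact h₂.symm.trans_le (meanPopulation_mono hmono (pos_of_isFixedPt h₂) le_sup_right)

lemma exists_isFixedPt_meanPopulation (hp : N.IsAllocation m p) (hmono : IsMonotone p) :
    ∃ y, Function.IsFixedPt (N.meanPopulation p) y := by
  let a : ι → J → ℝ := fun i j => N.lam i j * meanSojourn (N.F j) (N.cmax j)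
  let b : ι → J → ℝ := fun i j => N.lam i j * meanSojourn (N.F j) 0
  have hpos {y : ι → J → ℝ} (hy : y ∈ Icc a b) (i j) : 0 < y i j :=
    (N.lam_mul_meanSojourn_pos i j _).trans_le (hy.1 i j)
  have hab : a ≤ b := fun i j => N.lam_mul_meanSojourn_anti i j (N.cmax_pos j).le
  have hmaps : MapsTo (N.meanPopulation p) (Icc a b) (Icc a b) := fun y hy =>
    ⟨fun i j => N.lam_mul_meanSojourn_anti i j (hp.le_cmax (fun i j => (hpos hy i j).le) i j),
      fun i j => N.lam_mul_meanSojourn_anti i j (hp.nonneg (fun i j => (hpos hy i j).le) i j)⟩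
  obtain ⟨y, -, hy⟩ := exists_isFixedPt_of_monotoneOn_Icc hab
    (fun y hy w _ hyw => meanPopulation_mono hmono (hpos hy) hyw) hmaps
  exact ⟨y, hy⟩

lemma gammaInf_of_top {i : ι} (hK : N.K i = ⊤) (j : J) :
    N.gammaInf i j = ENNReal.ofReal (N.lam i j) := by
  have hsum : 0 < ∑ j', N.lam i j' :=
    Finset.sum_pos (fun j' _ => N.lam_pos i j') ⟨j, Finset.mem_univ j⟩
  have hfin : (∑ j', ENNReal.ofReal (N.lam i j') / ENNReal.ofReal (∑ k, N.lam i k) *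
      ∫⁻ x, ENNReal.ofReal x.2 ∂(N.F j')) ≠ ⊤ := by
    refine (ENNReal.sum_lt_top.2 fun j' _ => ENNReal.mul_lt_top ?_ ?_).ne
    · exact ENNReal.div_lt_top ENNReal.ofReal_ne_top (by simpa using hsum)
    · exact (N.F_mean j').lintegral_lt_top
  rw [gammaInf, hK, ENat.toENNReal_top, ENNReal.top_mul (ENNReal.inv_ne_zero.2 hfin),
    min_top_right]
  exact ENNReal.div_mul_cancel (by simpa using hsum) ENNReal.ofReal_ne_top

lemma ofReal_meanPopulation (hp : N.IsAllocation m p) (hK : ∀ i, N.K i = ⊤) (hy : 0 ≤ y) (i : ι)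
    (j : J) : ENNReal.ofReal (N.meanPopulation p y i j) = N.gammaInf i j *
      ∫⁻ x, min (ENNReal.ofReal x.2) (ENNReal.ofReal x.1 / ENNReal.ofReal (p y i j)) ∂(N.F j) := by
  rw [gammaInf_of_top (hK i), meanPopulation, ENNReal.ofReal_mul (N.lam_pos i j).le, meanSojourn,
    ofReal_integral_eq_lintegral_ofReal (integrable_sojourn (N.F_pos j) (N.F_mean j))
      ((N.F_pos j).mono fun _ hx => (sojourn_pos hx).le)]
  congr 1
  exact lintegral_congr_ae ((N.F_pos j).mono fun _ hx => ofReal_sojourn (hp.nonneg hy i j) hx)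

lemma isFixedPoint_iff (hp : N.IsAllocation m p) (hK : ∀ i, N.K i = ⊤) :
    N.IsFixedPoint p y ↔ Function.IsFixedPt (N.meanPopulation p) y := by
  constructor
  · intro h
    have hy : 0 ≤ y := fun i j => (h i j).1
    funext i j
    refine ((ENNReal.ofReal_eq_ofReal_iff (hy i j) (N.lam_mul_meanSojourn_pos i j _).le).1 ?_).symm
    exact (h i j).2.trans (ofReal_meanPopulation hp hK hy i j).symm
  · intro h i j
    have hy : 0 ≤ y := fun i j => (pos_of_isFixedPt h i j).le
    exact ⟨hy i j, by rw [← ofReal_meanPopulation hp hK hy, h]⟩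

end Network

end MeanPopulation

section FluidModel

lemma tendsto_measureReal_le_snd (μ : Measure (ℝ × ℝ)) [IsFiniteMeasure μ] :
    Tendsto (fun t : ℝ => μ.real {x | t ≤ x.2}) atTop (𝓝 0) := by
  have hlim : Tendsto (fun t : ℝ => μ {x | t ≤ x.2}) atTop (𝓝 (μ (⋂ t : ℝ, {x | t ≤ x.2}))) :=
    tendsto_measure_iInter_atTop
      (fun t => (measurableSet_le measurable_const measurable_snd).nullMeasurableSet)
      (fun s t hst x hx => le_trans hst hx) ⟨0, measure_ne_top _ _⟩
  have hempty : (⋂ t : ℝ, {x : ℝ × ℝ | t ≤ x.2}) = ∅ :=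
    eq_empty_of_forall_notMem fun x hx => (lt_add_one x.2).not_ge (mem_iInter.1 hx (x.2 + 1))
  rw [hempty, measure_empty] at hlim
  exact (ENNReal.tendsto_toReal ENNReal.zero_ne_top).comp hlim

namespace Network

variable {ι J : Type*} [Fintype ι] [Fintype J] {N : Network ι J} {m : FlowModel}
  {p : (ι → J → ℝ) → ι → J → ℝ} {y : ι → J → ℝ} {i : ι} {j : J}

lemma gammaT_of_top {q : ℝ → ι → J → ℝ} (hK : N.K i = ⊤) :
    N.gammaT q i j = fun _ => N.lam i j := by
  funext t
  simp [gammaT, hK]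

lemma isInvariantPoint_of_isFixedPt (hp : N.IsAllocation m p) (hK : ∀ i, N.K i = ⊤)
    (hy : Function.IsFixedPt (N.meanPopulation p) y) : N.IsInvariantPoint p y := by
  have hy0 (i j) : 0 ≤ y i j := (pos_of_isFixedPt hy i j).le
  have hr (i j) : 0 ≤ p y i j := hp.nonneg hy0 i j
  have hexcess_zero (i j) : (excessLaw (N.F j) (p y i j)).real (Ici 0) = 1 := by
    simp [excessLaw_real_Ici (N.F_pos j) (N.F_mean j) (hr i j) le_rfl]
  refine ⟨fun i j => stationaryLaw (N.F j) (p y i j), fun i j =>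
    ⟨isProbabilityMeasure_stationaryLaw (N.F_pos j) (N.F_mean j) (hr i j),
      ae_stationaryLaw_nonneg (hr i j)⟩, fun _ _ => hy0, continuousOn_const,
    fun _ _ _ _ => intervalIntegrable_const,
    fun t i j => y i j * (excessLaw (N.F j) (p y i j)).real (Ici t) +
      ∫ s in 0..t, N.lam i j * (N.F j).real {x | t - s ≤ x.2}, fun i j => ?_,
    fun t _ i j => ?_, fun t _ i j => ?_, fun t ht i j => ?_⟩
  · simp [hexcess_zero]
  · simp only [gammaT_of_top (hK _), intervalIntegrable_const]
  · simp [gammaT_of_top (hK _), stationaryLaw_real_le_snd, hexcess_zero]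
  have hinitial : (stationaryLaw (N.F j) (p y i j)).real
      {x | (∫ _ in 0..t, p y i j) < x.1 ∧ t ≤ x.2} =
        (excessLaw (N.F j) (p y i j)).real (Ici t) := by
    rw [← survival_stationaryLaw (hr i j)]
    simp [survival, mul_comm]
  have hnew : ∫ s in 0..t, presence (N.F j) (fun _ => p y i j) t s =
      ∫ v in 0..t, survival (N.F j) (p y i j) v := by rw [integral_presence_const, sub_zero]
  simp only [gammaT_of_top (hK _), intervalIntegral.integral_const_mul]
  refine Eq.trans ?_ (congrArg₂ (fun a b => y i j * a + N.lam i j * b) hinitial hnew).symm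
  calc y i j
    _ = N.lam i j * meanSojourn (N.F j) (p y i j) := (congrFun₂ hy i j).symm
    _ = N.lam i j * meanSojourn (N.F j) (p y i j) * (excessLaw (N.F j) (p y i j)).real (Ici t) +
          N.lam i j * ∫ v in 0..t, survival (N.F j) (p y i j) v := by
      rw [mul_assoc, ← mul_add, meanSojourn_mul_excessLaw_add (N.F_pos j) (N.F_mean j) (hr i j) ht]
    _ = y i j * (excessLaw (N.F j) (p y i j)).real (Ici t) +
          N.lam i j * ∫ v in 0..t, survival (N.F j) (p y i j) v := by
      congr 2
      exact congrFun₂ hy i j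

namespace IsFluidSolution

variable {F₀ : ι → J → Measure (ℝ × ℝ)} {z : ℝ → ι → J → ℝ}

lemma eq_add_integral_presence (hK : ∀ i, N.K i = ⊤) (hz : N.IsFluidSolution p F₀ z) {t : ℝ}
    (ht : 0 ≤ t) (i : ι) (j : J) :
    z t i j = z 0 i j * (F₀ i j).real {x | (∫ v in 0..t, p (z v) i j) < x.1 ∧ t ≤ x.2} +
      N.lam i j * ∫ s in 0..t, presence (N.F j) (fun v => p (z v) i j) t s := by
  obtain ⟨-, -, -, -, q, -, -, -, hz⟩ := hz
  rw [hz t ht i j, ← intervalIntegral.integral_const_mul]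
  simp only [gammaT_of_top (hK i), presence]

lemma nonneg (hz : N.IsFluidSolution p F₀ z) {t : ℝ} (ht : 0 ≤ t) : 0 ≤ z t := hz.2.1 t ht

lemma eventually_lt (hp : N.IsAllocation m p) (hK : ∀ i, N.K i = ⊤) (hz : N.IsFluidSolution p F₀ z)
    {r a : ℝ} (hr : 0 ≤ r) (hpr : ∀ᶠ t in atTop, p (z t) i j ≤ r)
    (ha : a < N.lam i j * meanSojourn (N.F j) r) : ∀ᶠ t in atTop, a < z t i j := by
  filter_upwards [eventually_lt_integral_presence (N.F_pos j) (N.F_mean j)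
    (fun t ht => hz.2.2.2.1 t ht i j) (fun t ht => hp.nonneg (hz.nonneg ht) i j) hr hpr
    ((div_lt_iff₀' (N.lam_pos i j)).2 ha), eventually_ge_atTop 0] with t hpresence ht
  calc a
    _ < N.lam i j * ∫ s in 0..t, presence (N.F j) (fun v => p (z v) i j) t s :=
      (div_lt_iff₀' (N.lam_pos i j)).1 hpresence
    _ ≤ z t i j := by
      rw [hz.eq_add_integral_presence hK ht]
      exact le_add_of_nonneg_left (mul_nonneg (hz.nonneg le_rfl i j) measureReal_nonneg)

lemma eventually_gt (hp : N.IsAllocation m p) (hK : ∀ i, N.K i = ⊤) (hz : N.IsFluidSolution p F₀ z)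
    {r a : ℝ} (hr : 0 ≤ r) (hrp : ∀ᶠ t in atTop, r ≤ p (z t) i j)
    (ha : N.lam i j * meanSojourn (N.F j) r < a) : ∀ᶠ t in atTop, z t i j < a := by
  obtain ⟨b, hrb, hba⟩ := exists_between ha
  have := (hz.1 i j).1
  have hinitial := (tendsto_measureReal_le_snd (F₀ i j)).const_mul (z 0 i j)
  rw [mul_zero] at hinitial
  filter_upwards [eventually_integral_presence_lt (N.F_pos j) (N.F_mean j)
    (fun t ht => hz.2.2.2.1 t ht i j) (fun t ht => hp.nonneg (hz.nonneg ht) i j) hr hrp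
    ((lt_div_iff₀' (N.lam_pos i j)).2 hrb), hinitial.eventually_lt_const (sub_pos.2 hba),
    eventually_ge_atTop 0] with t hpresence hinitial_lt ht
  calc z t i j
    _ ≤ z 0 i j * (F₀ i j).real {x | t ≤ x.2} +
          N.lam i j * ∫ s in 0..t, presence (N.F j) (fun v => p (z v) i j) t s := by
      rw [hz.eq_add_integral_presence hK ht]
      gcongr
      · exact hz.nonneg le_rfl i j
      · exact measure_ne_top _ _
      · exact And.right
    _ < a - b + b := add_lt_add hinitial_lt ((lt_div_iff₀' (N.lam_pos i j)).1 hpresence)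
    _ = a := sub_add_cancel a b

lemma isBoundedUnder_ge (hz : N.IsFluidSolution p F₀ z) (i : ι) (j : J) :
    atTop.IsBoundedUnder (· ≥ ·) fun t => z t i j :=
  isBoundedUnder_of_eventually_ge ((eventually_ge_atTop 0).mono fun _ ht => hz.nonneg ht i j)

lemma isBoundedUnder_le (hp : N.IsAllocation m p) (hK : ∀ i, N.K i = ⊤)
    (hz : N.IsFluidSolution p F₀ z) (i : ι) (j : J) :
    atTop.IsBoundedUnder (· ≤ ·) fun t => z t i j :=
  isBoundedUnder_of_eventually_le ((hz.eventually_gt hp hK le_rfl ((eventually_ge_atTop 0).mono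
    fun _ ht => hp.nonneg (hz.nonneg ht) i j) (lt_add_one _)).mono fun _ => le_of_lt)

lemma eventually_pos (hp : N.IsAllocation m p) (hK : ∀ i, N.K i = ⊤)
    (hz : N.IsFluidSolution p F₀ z) : ∀ᶠ t in atTop, ∀ i j, 0 < z t i j :=
  eventually_all.2 fun i => eventually_all.2 fun j => hz.eventually_lt hp hK (N.cmax_pos j).le
    ((eventually_ge_atTop 0).mono fun _ ht => hp.le_cmax (hz.nonneg ht) i j)
    (N.lam_mul_meanSojourn_pos i j _)

lemma le_liminf (hp : N.IsAllocation m p) (hK : ∀ i, N.K i = ⊤) (hz : N.IsFluidSolution p F₀ z)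
    {r : ℝ} (hr : 0 ≤ r) (hpr : ∀ᶠ t in atTop, p (z t) i j ≤ r) :
    N.lam i j * meanSojourn (N.F j) r ≤ liminf (fun t => z t i j) atTop :=
  le_of_forall_lt_imp_le_of_dense fun _ ha =>
    le_liminf_of_le (hz.isBoundedUnder_le hp hK i j).isCoboundedUnder_ge
      ((hz.eventually_lt hp hK hr hpr ha).mono fun _ => le_of_lt)

lemma limsup_le (hp : N.IsAllocation m p) (hK : ∀ i, N.K i = ⊤) (hz : N.IsFluidSolution p F₀ z)
    {r : ℝ} (hr : 0 ≤ r) (hrp : ∀ᶠ t in atTop, r ≤ p (z t) i j) :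
    limsup (fun t => z t i j) atTop ≤ N.lam i j * meanSojourn (N.F j) r :=
  le_of_forall_gt_imp_ge_of_dense fun _ ha =>
    limsup_le_of_le (hz.isBoundedUnder_ge i j).isCoboundedUnder_le
      ((hz.eventually_gt hp hK hr hrp ha).mono fun _ => le_of_lt)

lemma liminf_pos (hp : N.IsAllocation m p) (hK : ∀ i, N.K i = ⊤) (hz : N.IsFluidSolution p F₀ z)
    (i : ι) (j : J) : 0 < liminf (fun t => z t i j) atTop :=
  (N.lam_mul_meanSojourn_pos i j (N.cmax j)).trans_le (hz.le_liminf hp hK (N.cmax_pos j).le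
    ((eventually_ge_atTop 0).mono fun _ ht => hp.le_cmax (hz.nonneg ht) i j))

lemma liminf_le_limsup (hp : N.IsAllocation m p) (hK : ∀ i, N.K i = ⊤)
    (hz : N.IsFluidSolution p F₀ z) (i : ι) (j : J) :
    liminf (fun t => z t i j) atTop ≤ limsup (fun t => z t i j) atTop :=
  Filter.liminf_le_limsup (hz.isBoundedUnder_le hp hK i j) (hz.isBoundedUnder_ge i j)

lemma meanPopulation_liminf_le (hp : N.IsAllocation m p) (hmono : IsMonotone p)
    (hK : ∀ i, N.K i = ⊤) (hz : N.IsFluidSolution p F₀ z) :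
    N.meanPopulation p (fun i j => liminf (fun t => z t i j) atTop) ≤
      fun i j => liminf (fun t => z t i j) atTop := by
  set ℓ : ι → J → ℝ := fun i j => liminf (fun t => z t i j) atTop
  have hℓ (i j) : 0 < ℓ i j := hz.liminf_pos hp hK i j
  have hscaled {y : ι → J → ℝ} (hy : ∀ i j, 0 < y i j) (hyℓ : ∀ i j, y i j < ℓ i j) :
      N.meanPopulation p y ≤ ℓ := fun i j => by
    have hev : ∀ᶠ t in atTop, ∀ i j, y i j < z t i j := eventually_all.2 fun i =>
      eventually_all.2 fun j => eventually_lt_of_lt_liminf (hyℓ i j) (hz.isBoundedUnder_ge i j)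
    exact hz.le_liminf hp hK (hp.nonneg (fun i j => (hy i j).le) i j)
      (hev.mono fun t ht => hmono y (z t) hy (fun i j => (ht i j).le) i j)
  refine le_of_tendsto
    ((hp.tendsto_meanPopulation_smul hmono hℓ).mono_left (nhdsWithin_le_nhds (s := Iio 1))) ?_
  filter_upwards [Ioo_mem_nhdsLT zero_lt_one] with θ hθ
  exact hscaled (fun i j => mul_pos hθ.1 (hℓ i j)) fun i j => mul_lt_of_lt_one_left (hℓ i j) hθ.2

lemma limsup_le_meanPopulation (hp : N.IsAllocation m p) (hmono : IsMonotone p)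
    (hK : ∀ i, N.K i = ⊤) (hz : N.IsFluidSolution p F₀ z) :
    (fun i j => limsup (fun t => z t i j) atTop) ≤
      N.meanPopulation p (fun i j => limsup (fun t => z t i j) atTop) := by
  set u : ι → J → ℝ := fun i j => limsup (fun t => z t i j) atTop
  have hu (i j) : 0 < u i j := (hz.liminf_pos hp hK i j).trans_le (hz.liminf_le_limsup hp hK i j)
  have hscaled {y : ι → J → ℝ} (huy : ∀ i j, u i j < y i j) : u ≤ N.meanPopulation p y :=
    fun i j => by
    have hev : ∀ᶠ t in atTop, ∀ i j, z t i j < y i j := eventually_all.2 fun i =>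
      eventually_all.2 fun j =>
        eventually_lt_of_limsup_lt (huy i j) (hz.isBoundedUnder_le hp hK i j)
    exact hz.limsup_le hp hK (hp.nonneg (fun i j => ((hu i j).trans (huy i j)).le) i j)
      ((hev.and (hz.eventually_pos hp hK)).mono fun t ht =>
        hmono (z t) y ht.2 (fun i j => (ht.1 i j).le) i j)
  refine ge_of_tendsto
    ((hp.tendsto_meanPopulation_smul hmono hu).mono_left (nhdsWithin_le_nhds (s := Ioi 1))) ?_
  filter_upwards [self_mem_nhdsWithin] with θ hθ
  exact hscaled fun i j => lt_mul_of_one_lt_left (hu i j) hθ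

lemma exists_isFixedPt_tendsto (hp : N.IsAllocation m p) (hmono : IsMonotone p)
    (hK : ∀ i, N.K i = ⊤) (hinf : ∀ j, N.infRatio j ≤ 1 / N.cmax j)
    (hz : N.IsFluidSolution p F₀ z) :
    ∃ y, Function.IsFixedPt (N.meanPopulation p) y ∧
      ∀ i j, Tendsto (fun t => z t i j) atTop (𝓝 (y i j)) := by
  have hlow := hz.meanPopulation_liminf_le hp hmono hK
  have hhigh := hz.limsup_le_meanPopulation hp hmono hK
  have heq := eq_of_meanPopulation_le_of_le_meanPopulation hp hmono hinf (hz.liminf_pos hp hK)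
    (hz.liminf_le_limsup hp hK) hlow hhigh
  rw [← heq] at hhigh
  exact ⟨_, hlow.antisymm hhigh, fun i j => tendsto_of_liminf_eq_limsup rfl
    (congrFun₂ heq i j).symm (hz.isBoundedUnder_le hp hK i j) (hz.isBoundedUnder_ge i j)⟩

end IsFluidSolution
end Network

end FluidModel

end EVCharging
end

theorem proposition2 {ι J : Type*} [Fintype ι] [Fintype J] (N : EVCharging.Network ι J)
    (m : EVCharging.FlowModel) (p : (ι → J → ℝ) → ι → J → ℝ)
    (hp : N.IsAllocation m p) (hmono : EVCharging.IsMonotone p)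
    (hK : ∀ i, N.K i = ⊤) (hinf : ∀ j, N.infRatio j ≤ 1 / N.cmax j) :
    ∃ zstar : ι → J → ℝ,
      (∀ y : ι → J → ℝ, N.IsInvariantPoint p y ↔ y = zstar) ∧
      (∀ y : ι → J → ℝ, N.IsFixedPoint p y ↔ y = zstar) ∧
      ∀ (F₀ : ι → J → MeasureTheory.Measure (ℝ × ℝ)) (z : ℝ → ι → J → ℝ),
        N.IsFluidSolution p F₀ z →
          ∀ i j, Filter.Tendsto (fun t => z t i j) Filter.atTop (nhds (zstar i j)) := by
  obtain ⟨y, hy⟩ := EVCharging.Network.exists_isFixedPt_meanPopulation hp hmono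
  have huniq (w) (hw : Function.IsFixedPt (N.meanPopulation p) w) : w = y :=
    EVCharging.Network.isFixedPt_meanPopulation_unique hp hmono hinf hw hy
  have hlim (F₀) (z : ℝ → ι → J → ℝ) (hz : N.IsFluidSolution p F₀ z) (i j) :
      Filter.Tendsto (fun t => z t i j) Filter.atTop (nhds (y i j)) := by
    obtain ⟨w, hw, hzw⟩ := hz.exists_isFixedPt_tendsto hp hmono hK hinf
    exact huniq w hw ▸ hzw i j
  refine ⟨y, fun w => ⟨fun ⟨F₀, hw⟩ => ?_, ?_⟩, fun w => ?_, hlim⟩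
  · funext i j
    exact tendsto_nhds_unique tendsto_const_nhds (hlim F₀ _ hw i j)
  · rintro rfl
    exact EVCharging.Network.isInvariantPoint_of_isFixedPt hp hK hy
  · rw [EVCharging.Network.isFixedPoint_iff hp hK]
    exact ⟨huniq w, fun h => h ▸ hy⟩
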